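/- Let $m\ge 4$. Equip $\mathbb{C}^{2m}$, with standard basis $e_1,\dots,e_{2m}$, with the symmetric bilinear form $(e_i,e_j)=\delta_{i,2m+1-j}$, and let $\mathfrak{so}_{2m}$ be the Lie algebra of matrices that are skew-adjoint for this form. Identify $\bigwedge^2\mathbb{C}^{2m}$ with $\mathfrak{so}_{2m}$ by the linear isomorphism that sends $v_1\wedge v_2$ to the endomorphism $u\mapsto (v_1,u)\,v_2-(v_2,u)\,v_1$. Call $\alpha\in\bigwedge^2\mathbb{C}^{2m}$ decomposable if $\alpha=v_1\wedge v_2$ for some $v_1,v_2\in\mathbb{C}^{2m}$, and isotropic if $(\iota_{v_1^*}\alpha,\iota_{v_2^*}\alpha)=0$ for all $v_1^*,v_2^*\in(\mathbb{C}^{2m})^*$, where $\iota_{v^*}(v_1\wedge v_2)=v^*(v_1)\,v_2-v^*(v_2)\,v_1$. Among the adjoint orbits (under $SO_{2m}(\mathbb{C})$) of nilpotent elements of $\mathfrak{so}_{2m}$ there is exactly one, denoted $\mathcal{O}_{\min}$, whose dimension is minimal among those of positive dimension. Its closure, both in the Zariski topology and in the Euclidean topology, is, under the identification above, $$\overline{\mathcal{O}}_{\min}=\Bigl\{\alpha\in\textstyle\bigwedge^2\mathbb{C}^{2m}\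 \Big|\ \alpha\text{ is decomposable and isotropic}\Bigr\}.$$ -/

import Mathlib

noncomputable section

namespace MinOrbit

attribute [local instance 100] LieRing.ofAssociativeRing

/-- The complex vector space `ℂ^{2m}` (column vectors). -/
abbrev V (m : ℕ) : Type := Fin (2 * m) → ℂ

/-- Gram matrix of the form `(e_i, e_j) = δ_{i, 2m+1-j}` (indices `1, …, 2m` in the formula;
`Fin.rev` is the same reflection for indices `0, …, 2m-1`). -/
def J (m : ℕ) : Matrix (Fin (2 * m)) (Fin (2 * m)) ℂ :=
  Matrix.of fun i j => if i = Fin.rev j then 1 else 0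

/-- The bilinear form `( , )` on `ℂ^{2m}`. -/
def form (m : ℕ) : LinearMap.BilinForm ℂ (V m) := Matrix.toBilin' (J m)

/-- The Lie algebra `so_{2m}` of matrices skew-adjoint for the form `( , )`. -/
abbrev so (m : ℕ) : LieSubalgebra ℂ (Matrix (Fin (2 * m)) (Fin (2 * m)) ℂ) :=
  skewAdjointMatricesLieSubalgebra (J m)

/-- The group `SO_{2m}(ℂ)` of matrices of determinant one preserving the form `( , )`. -/
def SO (m : ℕ) : Subgroup (Matrix.SpecialLinearGroup (Fin (2 * m)) ℂ) where
  carrier := {g | g.1.transpose * J m * g.1 = J m}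
  one_mem' := by simp
  mul_mem' := by
    intro a b ha hb
    simp only [Set.mem_ofPred_eq, Matrix.SpecialLinearGroup.coe_mul,
      Matrix.transpose_mul] at *
    calc b.1.transpose * a.1.transpose * J m * (a.1 * b.1)
        = b.1.transpose * (a.1.transpose * J m * a.1) * b.1 := by simp only [Matrix.mul_assoc]
      _ = J m := by rw [ha, hb]
  inv_mem' := by
    intro a ha
    simp only [Set.mem_ofPred_eq] at *
    have h1 : a.1 * (a⁻¹).1 = 1 := by
      rw [← Matrix.SpecialLinearGroup.coe_mul]; simp
    have h2 : (a⁻¹).1.transpose * a.1.transpose = 1 := by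
      rw [← Matrix.transpose_mul, h1, Matrix.transpose_one]
    calc (a⁻¹).1.transpose * J m * (a⁻¹).1
        = (a⁻¹).1.transpose * (a.1.transpose * J m * a.1) * (a⁻¹).1 := by rw [ha]
      _ = ((a⁻¹).1.transpose * a.1.transpose) * J m * (a.1 * (a⁻¹).1) := by
          simp only [Matrix.mul_assoc]
      _ = J m := by rw [h1, h2]; simp

/-- The adjoint orbit `{g X g⁻¹ : g ∈ SO_{2m}(ℂ)}` of `X ∈ so_{2m}`. -/
def adjointOrbit (m : ℕ) (X : so m) : Set (so m) :=
  {Y | ∃ g ∈ SO m, Y.1 = g.1 * X.1 * (g⁻¹).1}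

/-- The complex dimension of the adjoint orbit of `X`, i.e. the dimension of its tangent space
`[so_{2m}, X]` at `X` (equivalently `dim so_{2m} - dim` of the centralizer of `X`). -/
def orbitDim (m : ℕ) (X : so m) : ℕ :=
  Module.finrank ℂ (LinearMap.range (LieAlgebra.ad ℂ (so m) X))

/-- `O` is a nilpotent adjoint orbit of `so_{2m}` of minimal positive dimension. -/
def IsMinimalNilpotentOrbit (m : ℕ) (O : Set (so m)) : Prop :=
  ∃ X : so m, O = adjointOrbit m X ∧ IsNilpotent X.1 ∧ 0 < orbitDim m X ∧
    ∀ Y : so m, IsNilpotent Y.1 → 0 < orbitDim m Y → orbitDim m X ≤ orbitDim m Y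

/-- The Zariski closure of a subset `S` of a complex vector space: the points at which every
polynomial in linear functionals that vanishes on `S` vanishes. -/
def zariskiClosure {W : Type*} [AddCommGroup W] [Module ℂ W] (S : Set W) : Set W :=
  {x | ∀ p : MvPolynomial (Module.Dual ℂ W) ℂ,
    (∀ y ∈ S, MvPolynomial.eval (fun l => l y) p = 0) →
      MvPolynomial.eval (fun l => l x) p = 0}

/-- The bivector `v ∧ w`. -/
def wedge {m : ℕ} (v w : V m) : ⋀[ℂ]^2 (V m) := exteriorPower.ιMulti ℂ 2 ![v, w]

/-- The linear map on bivectors induced by an alternating bilinear map. -/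
def wedgeLift {m : ℕ} {N : Type*} [AddCommGroup N] [Module ℂ N]
    (f : V m →ₗ[ℂ] V m →ₗ[ℂ] N) (hf : ∀ v, f v v = 0) : ⋀[ℂ]^2 (V m) →ₗ[ℂ] N :=
  exteriorPower.alternatingMapLinearEquiv
    { toFun := fun v => f (v 0) (v 1)
      map_update_add' := by
        intro _ v i x y
        fin_cases i <;> simp [Function.update]
      map_update_smul' := by
        intro _ v i c x
        fin_cases i <;> simp [Function.update]
      map_eq_zero_of_eq' := by
        intro v i j h hij
        fin_cases i <;> fin_cases j <;> simp_all }

theorem wedgeLift_wedge {m : ℕ} {N : Type*} [AddCommGroup N] [Module ℂ N]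
    (f : V m →ₗ[ℂ] V m →ₗ[ℂ] N) (hf : ∀ v, f v v = 0) (v w : V m) :
    wedgeLift f hf (wedge v w) = f v w := by
  simp only [wedgeLift, wedge, exteriorPower.alternatingMapLinearEquiv_apply_ιMulti]
  simp

/-- The bilinear map `(v, w) ↦ (u ↦ (v, u) w - (w, u) v)`, as a matrix. -/
def phiBilin (m : ℕ) :
    V m →ₗ[ℂ] V m →ₗ[ℂ] Matrix (Fin (2 * m)) (Fin (2 * m)) ℂ :=
  LinearMap.mk₂ ℂ
    (fun v w => LinearMap.toMatrix'
      ((form m v).smulRight w - (form m w).smulRight v))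
    (by intro a b c; ext i j; simp [LinearMap.toMatrix'_apply]; ring)
    (by intro a b c; ext i j; simp [LinearMap.toMatrix'_apply]; ring)
    (by intro a b c; ext i j; simp [LinearMap.toMatrix'_apply]; ring)
    (by intro a b c; ext i j; simp [LinearMap.toMatrix'_apply]; ring)

/-- The bilinear map `(v, w) ↦ d(v) w - d(w) v`. -/
def contractBilin {m : ℕ} (d : Module.Dual ℂ (V m)) : V m →ₗ[ℂ] V m →ₗ[ℂ] V m :=
  LinearMap.mk₂ ℂ (fun v w => d v • w - d w • v)
    (by intro a b c; simp only [map_add]; module)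
    (by intro a b c; simp only [map_smul, smul_eq_mul]; module)
    (by intro a b c; simp only [map_add]; module)
    (by intro a b c; simp only [map_smul, smul_eq_mul]; module)

/-- The contraction `ι_d : ⋀²ℂ^{2m} → ℂ^{2m}`, `v ∧ w ↦ d(v) w - d(w) v`. -/
def contract {m : ℕ} (d : Module.Dual ℂ (V m)) : ⋀[ℂ]^2 (V m) →ₗ[ℂ] V m :=
  wedgeLift (contractBilin d) (by intro v; simp [contractBilin])

/-- `α` is decomposable: `α = v₁ ∧ v₂` for some vectors `v₁, v₂`. -/
def IsDecomposable {m : ℕ} (α : ⋀[ℂ]^2 (V m)) : Prop := ∃ v₁ v₂ : V m, α = wedge v₁ v₂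

/-- `α` is isotropic: `(ι_d α, ι_{d'} α) = 0` for all linear functionals `d, d'`. -/
def IsIsotropic {m : ℕ} (α : ⋀[ℂ]^2 (V m)) : Prop :=
  ∀ d d' : Module.Dual ℂ (V m), form m (contract d α) (contract d' α) = 0

theorem form_apply (m : ℕ) (v w : V m) : form m v w = ∑ i, v (Fin.rev i) * w i := by
  simp only [form, J, Matrix.toBilin'_apply, Matrix.of_apply]
  rw [Finset.sum_comm]
  simp

theorem form_comm (m : ℕ) (v w : V m) : form m v w = form m w v := by
  rw [form_apply, form_apply, ← Equiv.sum_comp Fin.revPerm]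
  simp [mul_comm]

theorem phiBilin_mulVec (m : ℕ) (v w u : V m) :
    (phiBilin m v w).mulVec u = form m v u • w - form m w u • v := by
  simp only [phiBilin, LinearMap.mk₂_apply, ← Matrix.toLin'_apply, Matrix.toLin'_toMatrix']
  simp

theorem mem_so_iff (m : ℕ) (A : Matrix (Fin (2 * m)) (Fin (2 * m)) ℂ) :
    A ∈ so m ↔ ∀ u v : V m, form m (A.mulVec u) v = - form m u (A.mulVec v) := by
  rw [mem_skewAdjointMatricesLieSubalgebra, mem_skewAdjointMatricesSubmodule,
    Matrix.IsSkewAdjoint, ← isAdjointPair_toLinearMap₂' (R := ℂ)]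
  have h : ∀ u v, Matrix.toLinearMap₂' ℂ (J m) u v = form m u v := fun _ _ => rfl
  simp only [LinearMap.IsAdjointPair, h, Matrix.toLin'_apply, LinearMap.neg_apply, map_neg]

theorem phiBilin_mem (m : ℕ) (v w : V m) : phiBilin m v w ∈ so m := by
  rw [mem_so_iff]
  intro a b
  simp only [phiBilin_mulVec, map_sub, map_smul, LinearMap.sub_apply, LinearMap.smul_apply,
    smul_eq_mul, form_comm m a]
  ring

/-- The linear map `⋀²ℂ^{2m} → so_{2m}` sending `v ∧ w` to `u ↦ (v, u) w - (w, u) v`. -/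
def phi (m : ℕ) : ⋀[ℂ]^2 (V m) →ₗ[ℂ] so m :=
  wedgeLift
    (LinearMap.mk₂ ℂ (fun v w => (⟨phiBilin m v w, phiBilin_mem m v w⟩ : so m))
      (by intro a b c; apply Subtype.ext; simp) (by intro a b c; apply Subtype.ext; simp)
      (by intro a b c; apply Subtype.ext; simp) (by intro a b c; apply Subtype.ext; simp))
    (by intro v; apply Subtype.ext; simp [phiBilin])

theorem phi_wedge_mulVec (m : ℕ) (v w u : V m) :
    (phi m (wedge v w)).1.mulVec u = form m v u • w - form m w u • v := by
  simp only [phi, wedgeLift_wedge, LinearMap.mk₂_apply, phiBilin_mulVec]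

theorem update_zero {m : ℕ} (a b c : V m) : Function.update ![a, c] 0 b = ![b, c] := by
  ext i : 1
  fin_cases i <;> simp

theorem update_one {m : ℕ} (a b c : V m) : Function.update ![a, c] 1 b = ![a, b] := by
  ext i : 1
  fin_cases i <;> simp

/-- `wedge` as a bilinear map. -/
def wedgeBilin (m : ℕ) : V m →ₗ[ℂ] V m →ₗ[ℂ] ⋀[ℂ]^2 (V m) :=
  LinearMap.mk₂ ℂ wedge
    (by intro a b c
        have := (exteriorPower.ιMulti ℂ 2 (M := V m)).map_update_add ![a, c] 0 a b
        simpa only [wedge, update_zero, update_one] using this)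
    (by intro r a c
        have := (exteriorPower.ιMulti ℂ 2 (M := V m)).map_update_smul ![a, c] 0 r a
        simpa only [wedge, update_zero, update_one] using this)
    (by intro a b c
        have := (exteriorPower.ιMulti ℂ 2 (M := V m)).map_update_add ![a, c] 1 b c
        simpa only [wedge, update_zero, update_one] using this)
    (by intro r a c
        have := (exteriorPower.ιMulti ℂ 2 (M := V m)).map_update_smul ![a, c] 1 r c
        simpa only [wedge, update_zero, update_one] using this)

theorem wedge_swap {m : ℕ} (v w : V m) : wedge v w = - wedge w v := by
  have := (exteriorPower.ιMulti ℂ 2 (M := V m)).map_swap ![w, v]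
    (i := 0) (j := 1) (by decide)
  rw [wedge, wedge, ← this]
  congr 1
  ext i : 1
  fin_cases i <;> simp

/-- The map `A ↦ ½ ∑ᵢ e_{2m+1-i} ∧ A eᵢ`, inverse to `phi`. -/
def psi (m : ℕ) : so m →ₗ[ℂ] ⋀[ℂ]^2 (V m) :=
  (2⁻¹ : ℂ) • ∑ i : Fin (2 * m),
    (wedgeBilin m (Pi.single (Fin.rev i) 1)) ∘ₗ
      (LinearMap.applyₗ (Pi.single i 1 : V m)) ∘ₗ
        Matrix.toLin'.toLinearMap ∘ₗ (so m).toSubmodule.subtype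

theorem psi_apply (m : ℕ) (A : so m) :
    psi m A = (2⁻¹ : ℂ) • ∑ i : Fin (2 * m),
      wedgeBilin m (Pi.single (Fin.rev i) 1) (A.1.mulVec (Pi.single i 1)) := by
  simp only [psi, LinearMap.smul_apply, LinearMap.sum_apply]
  rfl

theorem sum_single_rev (m : ℕ) (v : V m) :
    ∑ i : Fin (2 * m), form m v (Pi.single i 1) • (Pi.single (Fin.rev i) 1 : V m) = v := by
  have h : ∀ i, form m v (Pi.single i 1) = v (Fin.rev i) := by
    intro i; rw [form_apply]; simp [Pi.single_apply]
  simp only [h]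
  have := Equiv.sum_comp (Fin.revPerm (n := 2 * m))
    (fun i => v i • (Pi.single i 1 : V m))
  simp only [Fin.revPerm_apply] at this
  rw [this]
  ext j
  simp [Finset.sum_apply, Pi.single_apply]

theorem bivector_hom_ext {m : ℕ} {N : Type*} [AddCommGroup N] [Module ℂ N]
    (f g : ⋀[ℂ]^2 (V m) →ₗ[ℂ] N) (h : ∀ v w, f (wedge v w) = g (wedge v w)) : f = g := by
  apply exteriorPower.linearMap_ext
  ext v
  have hv : v = ![v 0, v 1] := by ext i : 1; fin_cases i <;> rfl
  have := h (v 0) (v 1)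
  rw [wedge, ← hv] at this
  exact this

theorem psi_phi (m : ℕ) : psi m ∘ₗ phi m = LinearMap.id := by
  apply bivector_hom_ext
  intro v w
  simp only [LinearMap.comp_apply, LinearMap.id_apply, psi_apply, phi_wedge_mulVec, map_sub,
    map_smul, Finset.sum_sub_distrib]
  have h : ∀ a b : V m, ∑ i : Fin (2 * m), form m a (Pi.single i 1) •
      wedgeBilin m (Pi.single (Fin.rev i) 1) b = wedge a b := by
    intro a b
    have : wedge a b = wedgeBilin m a b := rfl
    rw [this]
    conv_rhs => rw [← sum_single_rev m a]
    simp [LinearMap.sum_apply]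
  rw [h, h, wedge_swap w v, sub_neg_eq_add, ← two_smul ℂ, smul_smul]
  simp

theorem phi_psi (m : ℕ) : phi m ∘ₗ psi m = LinearMap.id := by
  ext1 A
  apply Subtype.ext
  apply Matrix.ext_of_mulVec_single
  intro k
  have hw : ∀ a b : V m, wedgeBilin m a b = wedge a b := fun _ _ => rfl
  have hA := (mem_so_iff m A.1).1 A.2
  simp only [LinearMap.comp_apply, LinearMap.id_apply, psi_apply, map_smul, map_sum, hw]
  generalize hu : (Pi.single k 1 : V m) = u
  have e1 : ((2⁻¹ : ℂ) • ∑ i : Fin (2 * m), phi m (wedge (Pi.single (Fin.rev i) 1)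
      (A.1.mulVec (Pi.single i 1)))).1.mulVec u = (2⁻¹ : ℂ) • ∑ i : Fin (2 * m),
      (phi m (wedge (Pi.single (Fin.rev i) 1) (A.1.mulVec (Pi.single i 1)))).1.mulVec u := by
    simp [Matrix.smul_mulVec, Matrix.sum_mulVec]
  rw [e1]
  simp only [phi_wedge_mulVec, hA, neg_smul, sub_neg_eq_add, Finset.sum_add_distrib]
  have e2 : ∑ i : Fin (2 * m), form m (Pi.single (Fin.rev i) 1) u •
      A.1.mulVec (Pi.single i 1) = A.1.mulVec u := by
    have : ∀ i, form m (Pi.single (Fin.rev i) 1) u = u i := by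
      intro i; rw [form_apply]; simp [Pi.single_apply]
    simp only [this, ← Matrix.mulVec_smul, ← Matrix.mulVec_sum]
    congr 1
    ext j
    simp [Finset.sum_apply, Pi.single_apply]
  have e3 : ∑ i : Fin (2 * m), form m (Pi.single i 1) (A.1.mulVec u) •
      (Pi.single (Fin.rev i) 1 : V m) = A.1.mulVec u := by
    conv_rhs => rw [← sum_single_rev m (A.1.mulVec u)]
    simp only [form_comm m (A.1.mulVec u)]
  rw [e2, e3, ← two_smul ℂ, smul_smul]
  simp

/-- The identification `⋀²ℂ^{2m} = so_{2m}`, under which `v ∧ w` corresponds to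
`u ↦ (v, u) w - (w, u) v`. -/
def bivectorEquivSo (m : ℕ) : ⋀[ℂ]^2 (V m) ≃ₗ[ℂ] so m :=
  LinearEquiv.ofLinearMap (phi m) (psi m) (phi_psi m) (psi_phi m)

end MinOrbit

end

/-!
The proof works with endomorphisms `A` of a finite-dimensional space `E` with a nondegenerate
symmetric form `B`, the bivector `v ∧ w` being the endomorphism `u ↦ (v, u) w - (w, u) v`.

A skew-adjoint `A` comes from a decomposable isotropic bivector if and only if `A² = 0` and
`(A a, b) A = A a ∧ A b` for all `a`, `b`, so these `A` form a Zariski closed cone. By Witt's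
theorem the nonzero ones form a single orbit under `O(E)`, and also under `SO(E)` when
`dim E > 4`, because a totally isotropic plane is then fixed by a reflection. This orbit
accumulates at `0` by scaling, so its closure in either topology is the cone.

It remains to compare dimensions. For `n = dim E`, the tangent space `[so(E), v ∧ w]` to this
orbit lies in the image of the `(2n - 3)`-dimensional tangent space of isotropic pairs at `(v, w)`
under the derivative of `(v, w) ↦ v ∧ w`, whose kernel there contains the three directions of
`SL₂`; so its dimension is at most `2n - 6`. A nilpotent skew-adjoint `Y` outside the cone either
satisfies `Y² = 0` and has rank at least `4`, or has `Y² ≠ 0`. The centralizer of `Y` is then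
small, since its elements are determined by few of their values, and the orbit of `Y` has
dimension at least `2n - 5`.
-/

noncomputable section

namespace MinOrbit

attribute [local instance 100] LieRing.ofAssociativeRing

open Module

section SkewEndomorphisms

variable {K E : Type*} [Field K] [AddCommGroup E] [Module K E] {B : LinearMap.BilinForm K E}
  {A : End K E}

theorem bilin_apply_eq_neg_of_isSkewAdjoint (hA : B.IsSkewAdjoint A) (x y : E) :
    B (A x) y = -B x (A y) := by
  simpa using hA x y

theorem bilin_apply_comm_of_isSkewAdjoint (hs : B.IsSymm) (hA : B.IsSkewAdjoint A) (x y : E) :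
    B (A x) y = -B (A y) x := by
  rw [bilin_apply_eq_neg_of_isSkewAdjoint hA, hs.eq x]

theorem bilin_apply_self_of_isSkewAdjoint [NeZero (2 : K)] (hs : B.IsSymm)
    (hA : B.IsSkewAdjoint A) (x : E) : B (A x) x = 0 := by
  have h : (2 : K) * B (A x) x = 0 := by
    linear_combination bilin_apply_comm_of_isSkewAdjoint hs hA x x
  exact (mul_eq_zero.1 h).resolve_left two_ne_zero

theorem exists_bilin_apply_eq_one (hB : B.Nondegenerate) (hA : A ≠ 0) :
    ∃ a b, B (A a) b = 1 := by
  obtain ⟨a, ha⟩ := DFunLike.ne_iff.1 hA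
  obtain ⟨b, hb⟩ := not_forall.1 (mt (hB.1 (A a)) ha)
  exact ⟨a, (B (A a) b)⁻¹ • b, by rw [map_smul, smul_eq_mul, inv_mul_cancel₀ hb]⟩

variable (B) in
/-- The endomorphism `u ↦ (v, u) w - (w, u) v` attached to the bivector `v ∧ w`, bilinearly in `v`
and `w`. -/
def wedgeEnd : E →ₗ[K] E →ₗ[K] End K E :=
  LinearMap.smulRightₗ ∘ₗ B - (LinearMap.smulRightₗ ∘ₗ B).flip

@[simp]
theorem wedgeEnd_apply (v w u : E) : wedgeEnd B v w u = B v u • w - B w u • v := rfl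

theorem isSkewAdjoint_wedgeEnd (hs : B.IsSymm) (v w : E) : B.IsSkewAdjoint (wedgeEnd B v w) := by
  intro a b
  simp only [wedgeEnd_apply, Pi.neg_apply, map_sub, map_smul, map_neg, LinearMap.sub_apply,
    LinearMap.smul_apply, smul_eq_mul, hs.eq a v, hs.eq a w]
  ring

theorem linearIndependent_of_wedgeEnd_ne_zero {v w : E} (h : wedgeEnd B v w ≠ 0) :
    LinearIndependent K ![v, w] := by
  have alternating (x : E) : wedgeEnd B x x = 0 := by ext; simp
  refine (LinearIndependent.pair_iff' fun hv => h (by simp [hv])).2 fun c hc => h ?_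
  rw [← hc, map_smul, alternating, smul_zero]

theorem wedgeEnd_ne_zero_of_linearIndependent (hB : B.Nondegenerate) {v w : E}
    (h : LinearIndependent K ![v, w]) : wedgeEnd B v w ≠ 0 := fun h0 => by
  refine h.ne_zero 0 (hB.1 v fun u => ?_)
  refine (LinearIndependent.pair_iff.1 h (-B w u) (B v u) ?_).2
  rw [neg_smul, neg_add_eq_sub]
  exact LinearMap.congr_fun h0 u

/-- The Plücker relations. -/
theorem bilin_wedgeEnd_smul_wedgeEnd (v w a b : E) :
    B (wedgeEnd B v w a) b • wedgeEnd B v w =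
      wedgeEnd B (wedgeEnd B v w a) (wedgeEnd B v w b) := by
  ext u
  simp only [LinearMap.smul_apply, wedgeEnd_apply, map_sub, map_smul, LinearMap.sub_apply,
    smul_eq_mul]
  module

variable (B) in
/-- The vectors `v`, `w` span a totally isotropic subspace. -/
def IsotropicPair (v w : E) : Prop := B v v = 0 ∧ B v w = 0 ∧ B w w = 0

variable (B) in
/-- The cone of the endomorphisms attached to the bivectors of totally isotropic subspaces. -/
def isotropicCone : Set (End K E) := {A | ∃ v w, IsotropicPair B v w ∧ A = wedgeEnd B v w}

theorem smul_mem_isotropicCone (hA : A ∈ isotropicCone B) (c : K) : c • A ∈ isotropicCone B := by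
  obtain ⟨v, w, ⟨hvv, hvw, hww⟩, rfl⟩ := hA
  exact ⟨c • v, w, ⟨by simp [hvv], by simp [hvw], hww⟩, by simp⟩

theorem mul_self_eq_zero_of_mem_isotropicCone (hs : B.IsSymm) (hA : A ∈ isotropicCone B) :
    A * A = 0 := by
  obtain ⟨v, w, ⟨hvv, hvw, hww⟩, rfl⟩ := hA
  ext u
  simp [hvv, hvw, hww, hs.eq w v]

theorem isotropicPair_apply (hA : B.IsSkewAdjoint A) (hsq : A * A = 0) (a b : E) :
    IsotropicPair B (A a) (A b) := by
  have h (x y : E) : B (A x) (A y) = 0 := by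
    rw [bilin_apply_eq_neg_of_isSkewAdjoint hA, ← Module.End.mul_apply, hsq, LinearMap.zero_apply,
      map_zero, neg_zero]
  exact ⟨h _ _, h _ _, h _ _⟩

theorem mem_isotropicCone_iff (hs : B.IsSymm) (hB : B.Nondegenerate) (hA : B.IsSkewAdjoint A) :
    A ∈ isotropicCone B ↔
      A * A = 0 ∧ ∀ a b, B (A a) b • A = wedgeEnd B (A a) (A b) := by
  constructor
  · intro h
    refine ⟨mul_self_eq_zero_of_mem_isotropicCone hs h, ?_⟩
    obtain ⟨v, w, -, rfl⟩ := h
    exact bilin_wedgeEnd_smul_wedgeEnd v w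
  · rintro ⟨hsq, plucker⟩
    rcases eq_or_ne A 0 with rfl | h0
    · exact ⟨0, 0, by simp [IsotropicPair], by simp⟩
    obtain ⟨a, b, hab⟩ := exists_bilin_apply_eq_one hB h0
    exact ⟨A a, A b, isotropicPair_apply hA hsq a b, by rw [← plucker, hab, one_smul]⟩

theorem linearIndependent_pair_apply [NeZero (2 : K)] (hs : B.IsSymm) (hA : B.IsSkewAdjoint A)
    {a b : E} (hab : B (A a) b = 1) : LinearIndependent K ![A a, A b] := by
  refine LinearIndependent.pair_iff.2 fun s t hst => ?_
  have pairing_a := congrArg (B · a) hst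
  have pairing_b := congrArg (B · b) hst
  simp only [map_add, map_smul, LinearMap.add_apply, LinearMap.smul_apply, map_zero,
    LinearMap.zero_apply, bilin_apply_self_of_isSkewAdjoint hs hA,
    bilin_apply_comm_of_isSkewAdjoint hs hA b a, hab, smul_eq_mul] at pairing_a pairing_b
  exact ⟨by simpa using pairing_b, by simpa using pairing_a⟩

/-- Subtracting from `A` the wedge of two of its values splits off a hyperbolic plane of the
alternating form `(A x, y)`, so the rank of `A` is even. -/
theorem exists_linearIndependent_four_apply [NeZero (2 : K)] (hs : B.IsSymm)
    (hB : B.Nondegenerate) (hA : B.IsSkewAdjoint A) (h : ∀ v w, A ≠ wedgeEnd B v w) :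
    ∃ v : Fin 4 → E, LinearIndependent K (A ∘ v) := by
  obtain ⟨a, b, hab⟩ := exists_bilin_apply_eq_one hB (A := A) fun h0 => h 0 0 (by simp [h0])
  have hba : B (A b) a = -1 := by rw [bilin_apply_comm_of_isSkewAdjoint hs hA, hab]
  set A' := A - wedgeEnd B (A a) (A b) with hA'
  have skew' : B.IsSkewAdjoint A' :=
    (LinearMap.mem_skewAdjointSubmodule A').1 <|
      sub_mem ((LinearMap.mem_skewAdjointSubmodule A).2 hA)
        ((LinearMap.mem_skewAdjointSubmodule _).2 (isSkewAdjoint_wedgeEnd hs _ _))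
  have apply_a : A' a = 0 := by
    simp [hA', bilin_apply_self_of_isSkewAdjoint hs hA, hba]
  have apply_b : A' b = 0 := by
    simp [hA', bilin_apply_self_of_isSkewAdjoint hs hA, hab]
  have apply_eq (x : E) : A' x = A (x - B (A a) x • b + B (A b) x • a) := by
    simp only [hA', LinearMap.sub_apply, wedgeEnd_apply, map_add, map_sub, map_smul]
    module
  obtain ⟨c, d, hcd⟩ := exists_bilin_apply_eq_one hB (sub_ne_zero.2 (h (A a) (A b)))
  rw [← hA'] at hcd
  refine ⟨![a, b, c - B (A a) c • b + B (A b) c • a, d - B (A a) d • b + B (A b) d • a],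
    Fintype.linearIndependent_iff.2 fun g hg => ?_⟩
  simp only [Fin.sum_univ_four, Function.comp_apply, Matrix.cons_val, ← apply_eq] at hg
  have orthogonal_a (x : E) : B (A' x) a = 0 := by
    rw [bilin_apply_eq_neg_of_isSkewAdjoint skew', apply_a, map_zero, neg_zero]
  have orthogonal_b (x : E) : B (A' x) b = 0 := by
    rw [bilin_apply_eq_neg_of_isSkewAdjoint skew', apply_b, map_zero, neg_zero]
  have h1 : g 1 = 0 := by
    simpa [bilin_apply_self_of_isSkewAdjoint hs hA, hba, orthogonal_a] using congrArg (B · a) hg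
  have h0 : g 0 = 0 := by
    simpa [bilin_apply_self_of_isSkewAdjoint hs hA, hab, orthogonal_b] using congrArg (B · b) hg
  rw [h0, h1, zero_smul, zero_smul, zero_add, zero_add] at hg
  have ⟨h2, h3⟩ := LinearIndependent.pair_iff.1 (linearIndependent_pair_apply hs skew' hcd) _ _ hg
  exact Fin.forall_fin_succ.2 ⟨h0, Fin.forall_fin_succ.2 ⟨h1, Fin.forall_fin_two.2 ⟨h2, h3⟩⟩⟩

end SkewEndomorphisms

section Dimension

variable {K E : Type*} [Field K] [AddCommGroup E] [Module K E]

theorem finrank_map_add_finrank_inf_ker {F : Type*} [AddCommGroup F] [Module K F]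
    [FiniteDimensional K E] (f : E →ₗ[K] F) (W : Submodule K E) :
    finrank K (W.map f) + finrank K (W ⊓ LinearMap.ker f : Submodule K E) = finrank K W := by
  rw [← LinearMap.finrank_range_add_finrank_ker (f.domRestrict W), LinearMap.range_domRestrict,
    LinearMap.ker_domRestrict, ← Submodule.map_comap_subtype, Submodule.finrank_map_subtype_eq]

variable {B : LinearMap.BilinForm K E} [FiniteDimensional K E]

theorem exists_bilin_apply_eq {ι : Type*} (hB : B.Nondegenerate) {v : ι → E}
    (hv : LinearIndependent K v) (c : ι → K) : ∃ u, ∀ i, B u (v i) = c i := by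
  obtain ⟨φ, hφ⟩ := LinearMap.exists_extend
    ((Finsupp.linearCombination K c).comp (hv.repr : Submodule.span K (Set.range v) →ₗ[K] ι →₀ K))
  refine ⟨(B.toDual hB).symm φ, fun i => ?_⟩
  rw [LinearMap.BilinForm.apply_toDual_symm_apply]
  have h := LinearMap.congr_fun hφ ⟨v i, Submodule.subset_span (Set.mem_range_self i)⟩
  simpa [hv.repr_eq_single i ⟨v i, _⟩ rfl] using h

theorem finrank_le_add_finrank_inf_ker_applyₗ (hB : B.Nondegenerate) {W : Submodule K (End K E)}
    {U : Submodule K E} {v : E} (h : ∀ A ∈ W, A v ∈ B.orthogonal U) :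
    finrank K W ≤ (finrank K E - finrank K U) +
      finrank K (W ⊓ LinearMap.ker (LinearMap.applyₗ v) : Submodule K (End K E)) := by
  have hle : W.map (LinearMap.applyₗ v) ≤ B.orthogonal U := by
    rintro _ ⟨A, hA, rfl⟩
    exact h A hA
  rw [← finrank_map_add_finrank_inf_ker (LinearMap.applyₗ v) W,
    ← LinearMap.BilinForm.finrank_orthogonal hB]
  gcongr
  exact Submodule.finrank_mono hle

theorem finrank_le_choose_of_le_ker [NeZero (2 : K)] (hs : B.IsSymm) (hB : B.Nondegenerate)
    {W : Submodule K (End K E)} (hW : W ≤ B.skewAdjointSubmodule) {U : Submodule K E}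
    (hU : ∀ A ∈ W, U ≤ LinearMap.ker A) :
    finrank K W ≤ (finrank K E - finrank K U).choose 2 := by
  induction hn : finrank K E - finrank K U generalizing U W with
  | zero =>
    have hU_top : U = ⊤ := Submodule.eq_top_of_finrank_eq <|
      (Submodule.finrank_le U).antisymm (Nat.sub_eq_zero_iff_le.1 hn)
    have hW_bot : W = ⊥ := (Submodule.eq_bot_iff W).2 fun A hA =>
      LinearMap.ker_eq_top.1 <| top_le_iff.1 <| hU_top ▸ hU A hA
    rw [hW_bot, finrank_bot]
    exact Nat.zero_le _
  | succ n ih =>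
    obtain ⟨v, hv⟩ : ∃ v, v ∉ U := by
      by_contra! h
      rw [(Submodule.eq_top_iff').2 h, finrank_top] at hn
      omega
    have finrank_sup := Submodule.finrank_sup_span_singleton hv
    have orthogonal (A) (hA : A ∈ W) : A v ∈ B.orthogonal (U ⊔ K ∙ v) := by
      have skew := (LinearMap.mem_skewAdjointSubmodule A).1 (hW hA)
      rw [LinearMap.BilinForm.mem_orthogonal_iff]
      intro x hx
      obtain ⟨u, hu, y, hy, rfl⟩ := Submodule.mem_sup.1 hx
      obtain ⟨c, rfl⟩ := Submodule.mem_span_singleton.1 hy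
      have h1 : A u = 0 := hU A hA hu
      rw [← neg_eq_zero, ← bilin_apply_eq_neg_of_isSkewAdjoint skew]
      simp [h1, bilin_apply_self_of_isSkewAdjoint hs skew]
    have value_le := finrank_le_add_finrank_inf_ker_applyₗ hB orthogonal
    have rest_le := ih (W := W ⊓ LinearMap.ker (LinearMap.applyₗ v)) (U := U ⊔ K ∙ v)
      (inf_le_left.trans hW)
      (fun A hA => sup_le (hU A hA.1) ((Submodule.span_singleton_le_iff_mem _ _).2 hA.2))
      (by omega)
    have choose_succ : (n + 1).choose 2 = n + n.choose 2 := by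
      rw [Nat.choose_succ_succ, Nat.choose_one_right]
    omega

end Dimension

section NilpotentEndomorphisms

variable {K E : Type*} [Field K] [AddCommGroup E] [Module K E] {Y : End K E}

theorem linearIndependent_sumElim_apply {ι : Type*} (hY : Y * Y = 0) {v : ι → E}
    (hv : LinearIndependent K (Y ∘ v)) : LinearIndependent K (Sum.elim (Y ∘ v) v) := by
  refine hv.sum_type hv.of_comp ((Submodule.range_ker_disjoint hv).symm.mono_left ?_)
  rw [Submodule.span_le]
  rintro _ ⟨i, rfl⟩
  exact LinearMap.congr_fun hY (v i)

theorem two_mul_le_finrank [FiniteDimensional K E] (hY : Y * Y = 0) {r : ℕ} {v : Fin r → E}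
    (hv : LinearIndependent K (Y ∘ v)) : 2 * r ≤ finrank K E := by
  have h := (linearIndependent_sumElim_apply hY hv).fintype_card_le_finrank
  rwa [Fintype.card_sum, Fintype.card_fin, ← two_mul] at h

theorem linearIndependent_pow_apply {r : ℕ} {v : E} (hv : (Y ^ r) v ≠ 0)
    (hv' : (Y ^ (r + 1)) v = 0) : LinearIndependent K fun i : Fin (r + 1) => (Y ^ (i : ℕ)) v := by
  induction r generalizing v with
  | zero =>
    have : Subsingleton (Fin (0 + 1)) := inferInstanceAs (Subsingleton (Fin 1))
    exact .of_subsingleton 0 hv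
  | succ r ih =>
    have tail_indep := ih (v := Y v) (by rwa [← Module.End.mul_apply, ← pow_succ])
      (by rwa [← Module.End.mul_apply, ← pow_succ])
    have notMem : v ∉ Submodule.span K (Set.range fun i : Fin (r + 1) => (Y ^ (i : ℕ)) (Y v)) := by
      have span_le : Submodule.span K (Set.range fun i : Fin (r + 1) => (Y ^ (i : ℕ)) (Y v)) ≤
          LinearMap.ker (Y ^ (r + 1)) := by
        rw [Submodule.span_le, Set.range_subset_iff]
        intro i
        have comm : Y ^ (r + 1) * (Y ^ (i : ℕ) * Y) = Y ^ (i : ℕ) * Y ^ (r + 1 + 1) := by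
          rw [← pow_succ, ← pow_add, ← pow_add]
          congr 1
          omega
        rw [SetLike.mem_coe, LinearMap.mem_ker, ← Module.End.mul_apply, ← Module.End.mul_apply,
          mul_assoc, comm, Module.End.mul_apply, hv', map_zero]
      exact fun h => hv (span_le h)
    convert tail_indep.finCons notMem with i
    refine i.cases rfl fun j => ?_
    rw [Fin.cons_succ, Fin.val_succ, pow_succ, Module.End.mul_apply]

theorem exists_linearIndependent_pow_apply (hY : IsNilpotent Y) {r : ℕ} (hr : Y ^ r ≠ 0) :
    ∃ v, LinearIndependent K fun i : Fin (r + 1) => (Y ^ (i : ℕ)) v := by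
  obtain ⟨k, hk⟩ : ∃ k, nilpotencyClass Y = r + k + 1 := by
    refine Nat.exists_eq_add_of_lt (not_le.1 fun h => hr ?_)
    exact pow_eq_zero_of_le h (pow_nilpotencyClass hY)
  obtain ⟨pow_eq_zero, pow_ne_zero⟩ := nilpotencyClass_eq_succ_iff.1 hk
  obtain ⟨w, hw⟩ := DFunLike.ne_iff.1 pow_ne_zero
  refine ⟨(Y ^ k) w, linearIndependent_pow_apply ?_ ?_⟩
  · rwa [← Module.End.mul_apply, ← pow_add]
  · rw [← Module.End.mul_apply, ← pow_add, add_right_comm, pow_eq_zero, LinearMap.zero_apply]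

end NilpotentEndomorphisms

section Centralizer

variable {K E : Type*} [Field K] [AddCommGroup E] [Module K E] {B : LinearMap.BilinForm K E}
  {A Y : End K E}

variable (B Y) in
/-- The centralizer of `Y` in the Lie algebra of skew-adjoint endomorphisms. -/
def skewCentralizer : Submodule K (End K E) :=
  B.skewAdjointSubmodule ⊓ LinearMap.ker (LieAlgebra.ad K (End K E) Y : End K (End K E))

theorem mem_skewCentralizer : A ∈ skewCentralizer B Y ↔ B.IsSkewAdjoint A ∧ Y * A = A * Y := by
  rw [skewCentralizer, Submodule.mem_inf, LinearMap.mem_skewAdjointSubmodule, LinearMap.mem_ker,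
    LieAlgebra.ad_apply, Ring.lie_def, sub_eq_zero]

theorem isSkewAdjoint_of_mem_skewCentralizer (hA : A ∈ skewCentralizer B Y) :
    B.IsSkewAdjoint A :=
  (mem_skewCentralizer.1 hA).1

theorem apply_comm_of_mem_skewCentralizer (hA : A ∈ skewCentralizer B Y) (x : E) :
    A (Y x) = Y (A x) :=
  LinearMap.congr_fun (mem_skewCentralizer.1 hA).2.symm x

theorem apply_apply_eq_zero_of_mem_skewCentralizer (hA : A ∈ skewCentralizer B Y) {x : E}
    (hx : A x = 0) : A (Y x) = 0 := by
  rw [apply_comm_of_mem_skewCentralizer hA, hx, map_zero]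

theorem apply_mem_orthogonal_of_mem_skewCentralizer [NeZero (2 : K)] (hs : B.IsSymm)
    (hA : A ∈ skewCentralizer B Y) {r : ℕ} {v : Fin (r + 1) → E}
    (kills : ∀ i : Fin r, A (v i.succ) = 0) :
    A (v 0) ∈ B.orthogonal (Submodule.span K (Set.range (Sum.elim (Y ∘ Fin.tail v) v))) := by
  have skew := isSkewAdjoint_of_mem_skewCentralizer hA
  have orthogonal_of_kills {x : E} (hx : A x = 0) : B x (A (v 0)) = 0 := by
    rw [← neg_eq_zero, ← bilin_apply_eq_neg_of_isSkewAdjoint skew, hx, map_zero,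
      LinearMap.zero_apply]
  have span_le : Submodule.span K (Set.range (Sum.elim (Y ∘ Fin.tail v) v)) ≤
      LinearMap.ker (B.flip (A (v 0))) := by
    rw [Submodule.span_le, Set.range_subset_iff, Sum.forall, Fin.forall_fin_succ]
    refine ⟨fun i => orthogonal_of_kills
      (apply_apply_eq_zero_of_mem_skewCentralizer hA (kills i)), ?_,
      fun i => orthogonal_of_kills (kills i)⟩
    exact (hs.eq _ _).trans (bilin_apply_self_of_isSkewAdjoint hs skew (v 0))
  exact LinearMap.BilinForm.mem_orthogonal_iff.2 fun x hx => span_le hx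

variable [FiniteDimensional K E]

theorem finrank_skewCentralizer_le_add_finrank_inf [NeZero (2 : K)] (hs : B.IsSymm)
    (hB : B.Nondegenerate) (hY : Y * Y = 0) {r : ℕ} {v : Fin r → E}
    (hv : LinearIndependent K (Y ∘ v)) :
    finrank K (skewCentralizer B Y) ≤ r * (finrank K E - r) +
      finrank K (skewCentralizer B Y ⊓ ⨅ i, LinearMap.ker (LinearMap.applyₗ (v i)) :
        Submodule K (End K E)) := by
  induction r with
  | zero => rw [iInf_of_empty, inf_top_eq, zero_mul, zero_add]
  | succ r ih =>
    have tail_le := ih (v := Fin.tail v) (hv.comp Fin.succ (Fin.succ_injective r))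
    have indep : LinearIndependent K (Sum.elim (Y ∘ Fin.tail v) v) := by
      convert (linearIndependent_sumElim_apply hY hv).comp (Sum.map Fin.succ id)
        ((Fin.succ_injective r).sumMap Function.injective_id) using 1
      ext (i | i) <;> rfl
    have orthogonal (A) (hA : A ∈ skewCentralizer B Y ⊓
        ⨅ i, LinearMap.ker (LinearMap.applyₗ (Fin.tail v i))) :=
      apply_mem_orthogonal_of_mem_skewCentralizer hs hA.1 fun i => (Submodule.mem_iInf _).1 hA.2 i
    have head_le := finrank_le_add_finrank_inf_ker_applyₗ hB orthogonal
    rw [finrank_span_eq_card indep, Fintype.card_sum, Fintype.card_fin, Fintype.card_fin,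
      inf_assoc] at head_le
    have inf_eq : (⨅ i, LinearMap.ker (LinearMap.applyₗ (v i)) : Submodule K (End K E)) =
        (⨅ i, LinearMap.ker (LinearMap.applyₗ (Fin.tail v i))) ⊓
          LinearMap.ker (LinearMap.applyₗ (v 0)) := by
      ext A
      simp [Fin.forall_fin_succ, Fin.tail, and_comm]
    rw [inf_eq]
    obtain ⟨k, hk⟩ := Nat.exists_eq_add_of_le (two_mul_le_finrank hY hv)
    rw [hk, show 2 * (r + 1) + k - r = r + 2 + k by omega] at tail_le
    rw [hk, show 2 * (r + 1) + k - (r + (r + 1)) = 1 + k by omega] at head_le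
    rw [hk, show 2 * (r + 1) + k - (r + 1) = r + 1 + k by omega]
    linarith

theorem finrank_skewCentralizer_add_le [NeZero (2 : K)] (hs : B.IsSymm) (hB : B.Nondegenerate)
    (hY : Y * Y = 0) {r : ℕ} {v : Fin r → E} (hv : LinearIndependent K (Y ∘ v)) :
    finrank K (skewCentralizer B Y) + r * (finrank K E - r - 1) ≤ (finrank K E).choose 2 := by
  have indep := linearIndependent_sumElim_apply hY hv
  have values_le := finrank_skewCentralizer_le_add_finrank_inf hs hB hY hv
  have rest_le := finrank_le_choose_of_le_ker hs hB
    (W := skewCentralizer B Y ⊓ ⨅ i, LinearMap.ker (LinearMap.applyₗ (v i)))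
    (U := Submodule.span K (Set.range (Sum.elim (Y ∘ v) v)))
    (inf_le_left.trans inf_le_left) (by
      intro A hA
      have kills (i : Fin r) : A (v i) = 0 := (Submodule.mem_iInf _).1 hA.2 i
      rw [Submodule.span_le, Set.range_subset_iff, Sum.forall]
      exact ⟨fun i => apply_apply_eq_zero_of_mem_skewCentralizer hA.1 (kills i), kills⟩)
  rw [finrank_span_eq_card indep, Fintype.card_sum, Fintype.card_fin, ← two_mul] at rest_le
  obtain ⟨k, hk⟩ := Nat.exists_eq_add_of_le (two_mul_le_finrank hY hv)
  rcases r.eq_zero_or_pos with rfl | hr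
  · simpa using values_le.trans (by simpa using rest_le)
  have choose_eq : (2 * r + k).choose 2 = k.choose 2 + r * (r + k) + r * (r + k - 1) := by
    qify [show 1 ≤ r + k by omega]
    push_cast [Nat.cast_choose_two]
    ring
  rw [hk, show 2 * r + k - r = r + k by omega] at values_le ⊢
  rw [hk, Nat.add_sub_cancel_left] at rest_le
  linarith

theorem finrank_skewCentralizer_le_of_linearIndependent_pow_apply [NeZero (2 : K)] (hs : B.IsSymm)
    (hB : B.Nondegenerate) {r : ℕ} [NeZero r] {v : E}
    (hv : LinearIndependent K fun i : Fin r => (Y ^ (i : ℕ)) v) :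
    finrank K (skewCentralizer B Y) ≤
      (finrank K E - 1) + (finrank K E - r).choose 2 := by
  have hv0 : v ≠ 0 := by simpa using hv.ne_zero 0
  have value_le := finrank_le_add_finrank_inf_ker_applyₗ hB (W := skewCentralizer B Y)
    (U := K ∙ v) (v := v) (by
      intro A hA
      rw [LinearMap.BilinForm.orthogonal_span_singleton_eq_toLin_ker, LinearMap.mem_ker]
      exact (hs.eq _ _).trans (bilin_apply_self_of_isSkewAdjoint hs
        (isSkewAdjoint_of_mem_skewCentralizer hA) v))
  have rest_le := finrank_le_choose_of_le_ker hs hB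
    (W := skewCentralizer B Y ⊓ LinearMap.ker (LinearMap.applyₗ v))
    (U := Submodule.span K (Set.range fun i : Fin r => (Y ^ (i : ℕ)) v))
    (inf_le_left.trans inf_le_left) (by
      intro A hA
      rw [Submodule.span_le, Set.range_subset_iff]
      intro i
      have comm : Commute A Y := (mem_skewCentralizer.1 hA.1).2.symm
      rw [SetLike.mem_coe, LinearMap.mem_ker, ← Module.End.mul_apply, (comm.pow_right i).eq,
        Module.End.mul_apply, show A v = 0 from hA.2, map_zero])
  rw [finrank_span_singleton hv0] at value_le
  rw [finrank_span_eq_card hv, Fintype.card_fin] at rest_le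
  exact value_le.trans (by gcongr)

end Centralizer

section TangentSpace

variable {K E : Type*} [Field K] [AddCommGroup E] [Module K E] {B : LinearMap.BilinForm K E}
  {Y : End K E} {e f : E}

theorem isSkewAdjoint_of_mem_isotropicCone (hs : B.IsSymm) (hY : Y ∈ isotropicCone B) :
    B.IsSkewAdjoint Y := by
  obtain ⟨v, w, -, rfl⟩ := hY
  exact isSkewAdjoint_wedgeEnd hs v w

theorem exists_linearIndependent_apply_of_mem_isotropicCone [NeZero (2 : K)] (hs : B.IsSymm)
    (hB : B.Nondegenerate) (hY : Y ∈ isotropicCone B) (hY0 : Y ≠ 0) :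
    ∃ v : Fin 2 → E, LinearIndependent K (Y ∘ v) := by
  obtain ⟨a, b, hab⟩ := exists_bilin_apply_eq_one hB hY0
  refine ⟨![a, b], ?_⟩
  rw [← FinVec.map_eq]
  exact linearIndependent_pair_apply hs (isSkewAdjoint_of_mem_isotropicCone hs hY) hab

variable (B Y) in
/-- The tangent space at `Y` of the orbit of `Y` under the isometry group of `B`: the commutators
of `Y` with the skew-adjoint endomorphisms. -/
def tangentSpace : Submodule K (End K E) :=
  B.skewAdjointSubmodule.map (LieAlgebra.ad K (End K E) Y : End K (End K E))

theorem finrank_tangentSpace_add_finrank_skewCentralizer [FiniteDimensional K E] :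
    finrank K (tangentSpace B Y) + finrank K (skewCentralizer B Y) =
      finrank K B.skewAdjointSubmodule :=
  finrank_map_add_finrank_inf_ker _ _

variable (B e f) in
/-- The derivative of `(v, w) ↦ wedgeEnd B v w` at `(e, f)`. -/
def wedgeEndDerivative : E × E →ₗ[K] End K E :=
  ((wedgeEnd B).flip f).coprod (wedgeEnd B e)

@[simp]
theorem wedgeEndDerivative_apply (p : E × E) :
    wedgeEndDerivative B e f p = wedgeEnd B p.1 f + wedgeEnd B e p.2 := rfl

variable (B e f) in
/-- The tangent space at `(e, f)` of the variety of isotropic pairs. -/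
def isotropicPairTangent : Submodule K (E × E) :=
  LinearMap.ker (LinearMap.pi ![(B e).coprod 0, (B f).coprod (B e), (0 : E →ₗ[K] K).coprod (B f)] :
    E × E →ₗ[K] Fin 3 → K)

theorem mem_isotropicPairTangent {p : E × E} :
    p ∈ isotropicPairTangent B e f ↔ B e p.1 = 0 ∧ B f p.1 + B e p.2 = 0 ∧ B f p.2 = 0 := by
  simp [isotropicPairTangent, funext_iff, Fin.forall_fin_succ]

theorem tangentSpace_wedgeEnd_le [NeZero (2 : K)] (hs : B.IsSymm) :
    tangentSpace B (wedgeEnd B e f) ≤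
      (isotropicPairTangent B e f).map (wedgeEndDerivative B e f) := by
  rintro _ ⟨A, hA, rfl⟩
  have skew : B.IsSkewAdjoint A := (LinearMap.mem_skewAdjointSubmodule A).1 hA
  refine ⟨(-A e, -A f), mem_isotropicPairTangent.2 ?_, ?_⟩
  · have apply_self (x : E) : B x (A x) = 0 :=
      (hs.eq _ _).trans (bilin_apply_self_of_isSkewAdjoint hs skew x)
    have apply_comm : B f (A e) = -B e (A f) := by
      rw [← bilin_apply_eq_neg_of_isSkewAdjoint skew, hs.eq]
    simp [apply_self, apply_comm]
  · ext u
    simp only [wedgeEndDerivative_apply, LinearMap.add_apply, wedgeEnd_apply, map_neg,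
      LinearMap.neg_apply, LieAlgebra.ad_apply, Ring.lie_def, LinearMap.sub_apply,
      Module.End.mul_apply, map_sub, map_smul, bilin_apply_eq_neg_of_isSkewAdjoint skew]
    module

theorem linearIndependent_pairs (hef : LinearIndependent K ![e, f]) :
    LinearIndependent K ![((f, 0) : E × E), (e, -f), (0, e)] := by
  refine Fintype.linearIndependent_iff.2 fun g hg => ?_
  simp only [Fin.sum_univ_three, Matrix.cons_val_zero, Matrix.cons_val_one, Matrix.cons_val,
    Prod.smul_mk, Prod.mk_add_mk, Prod.mk_eq_zero, smul_zero, add_zero, zero_add, smul_neg] at hg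
  have ⟨h1, h0⟩ := LinearIndependent.pair_iff.1 hef (g 1) (g 0) (by rw [add_comm]; exact hg.1)
  have ⟨h2, _⟩ := LinearIndependent.pair_iff.1 hef (g 2) (-g 1)
    (by rw [neg_smul, add_comm]; exact hg.2)
  exact Fin.forall_fin_succ.2 ⟨h0, Fin.forall_fin_two.2 ⟨h1, h2⟩⟩

variable [FiniteDimensional K E]

theorem finrank_isotropicPairTangent (hs : B.IsSymm) (hB : B.Nondegenerate)
    (hef : LinearIndependent K ![e, f]) :
    finrank K (isotropicPairTangent B e f) + 3 = 2 * finrank K E := by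
  have surjective : Function.Surjective (LinearMap.pi
      ![(B e).coprod 0, (B f).coprod (B e), (0 : E →ₗ[K] K).coprod (B f)]) := by
    intro z
    obtain ⟨a, ha⟩ := exists_bilin_apply_eq hB hef ![z 0, 0]
    obtain ⟨b, hb⟩ := exists_bilin_apply_eq hB hef ![z 1, z 2]
    rw [Fin.forall_fin_two] at ha hb
    simp only [Matrix.cons_val_zero, Matrix.cons_val_one] at ha hb
    refine ⟨(a, b), ?_⟩
    simp [funext_iff, Fin.forall_fin_succ, hs.eq e, hs.eq f, ha, hb]
  have rank_nullity := LinearMap.finrank_range_add_finrank_ker (LinearMap.pi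
    ![(B e).coprod 0, (B f).coprod (B e), (0 : E →ₗ[K] K).coprod (B f)])
  rw [LinearMap.range_eq_top.2 surjective, finrank_top, finrank_fin_fun, finrank_prod,
    ← isotropicPairTangent] at rank_nullity
  omega

/-- The three directions come from the action of `SL₂` on the pairs with a given wedge. -/
theorem three_le_finrank_isotropicPairTangent_inf_ker (hs : B.IsSymm)
    (isotropic : IsotropicPair B e f) (hef : LinearIndependent K ![e, f]) :
    3 ≤ finrank K (isotropicPairTangent B e f ⊓ LinearMap.ker (wedgeEndDerivative B e f) :
      Submodule K (E × E)) := by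
  obtain ⟨ee, ef, ff⟩ := isotropic
  have fe : B f e = 0 := by rw [hs.eq, ef]
  have span_le : Submodule.span K (Set.range ![((f, 0) : E × E), (e, -f), (0, e)]) ≤
      isotropicPairTangent B e f ⊓ LinearMap.ker (wedgeEndDerivative B e f) := by
    rw [Submodule.span_le, Set.range_subset_iff, Fin.forall_fin_succ, Fin.forall_fin_two]
    have wedgeEnd_self (x : E) : wedgeEnd B x x = 0 := by ext; simp
    simp [mem_isotropicPairTangent, ee, ef, ff, fe, wedgeEnd_self]
  simpa only [finrank_span_eq_card (linearIndependent_pairs hef), Fintype.card_fin] using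
    Submodule.finrank_mono span_le

theorem finrank_tangentSpace_add_six_le [NeZero (2 : K)] (hs : B.IsSymm) (hB : B.Nondegenerate)
    (hY : Y ∈ isotropicCone B) (hY0 : Y ≠ 0) :
    finrank K (tangentSpace B Y) + 6 ≤ 2 * finrank K E := by
  obtain ⟨e, f, isotropic, rfl⟩ := hY
  have indep := linearIndependent_of_wedgeEnd_ne_zero hY0
  have tangent_le := Submodule.finrank_mono (tangentSpace_wedgeEnd_le (e := e) (f := f) hs)
  have := finrank_isotropicPairTangent hs hB indep
  have := three_le_finrank_isotropicPairTangent_inf_ker hs isotropic indep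
  have := finrank_map_add_finrank_inf_ker (wedgeEndDerivative B e f) (isotropicPairTangent B e f)
  omega

theorem finrank_skewCentralizer_lt_of_mem_isotropicCone [NeZero (2 : K)] (hs : B.IsSymm)
    (hB : B.Nondegenerate) (hY : Y ∈ isotropicCone B) (hY0 : Y ≠ 0) :
    finrank K (skewCentralizer B Y) < (finrank K E).choose 2 := by
  have hsq := mul_self_eq_zero_of_mem_isotropicCone hs hY
  obtain ⟨v, hv⟩ := exists_linearIndependent_apply_of_mem_isotropicCone hs hB hY hY0
  have := two_mul_le_finrank hsq hv
  have := finrank_skewCentralizer_add_le hs hB hsq hv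
  omega

theorem finrank_skewCentralizer_add_le_of_notMem_isotropicCone [NeZero (2 : K)] (hs : B.IsSymm)
    (hB : B.Nondegenerate) (skew : B.IsSkewAdjoint Y) (nilpotent : IsNilpotent Y)
    (hY : Y ∉ isotropicCone B) :
    finrank K (skewCentralizer B Y) + (2 * finrank K E - 5) ≤ (finrank K E).choose 2 := by
  by_cases hsq : Y * Y = 0
  · have not_wedgeEnd (v w : E) : Y ≠ wedgeEnd B v w := by
      rintro rfl
      exact hY ((mem_isotropicCone_iff hs hB skew).2 ⟨hsq, bilin_wedgeEnd_smul_wedgeEnd v w⟩)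
    obtain ⟨v, hv⟩ := exists_linearIndependent_four_apply hs hB skew not_wedgeEnd
    have := two_mul_le_finrank hsq hv
    have := finrank_skewCentralizer_add_le hs hB hsq hv
    omega
  · obtain ⟨v, hv⟩ := exists_linearIndependent_pow_apply nilpotent (r := 2) (by rwa [pow_two])
    have centralizer_le := finrank_skewCentralizer_le_of_linearIndependent_pow_apply hs hB hv
    have three_le := hv.fintype_card_le_finrank
    rw [Fintype.card_fin] at three_le
    obtain ⟨k, hk⟩ := Nat.exists_eq_add_of_le three_le
    have choose_eq : (2 + 1 + k).choose 2 = k.choose 2 + (2 + k) + (2 * k + 1) := by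
      qify
      push_cast [Nat.cast_choose_two]
      ring
    rw [hk, Nat.add_sub_cancel_left] at centralizer_le
    rw [hk]
    omega

end TangentSpace

section Isometries

variable {K E : Type*} [Field K] [AddCommGroup E] [Module K E] {B : LinearMap.BilinForm K E}

theorem isOrthogonal_mul {g h : End K E} (hg : B.IsOrthogonal g) (hh : B.IsOrthogonal h) :
    B.IsOrthogonal (g * h) := fun x y =>
  (hg (h x) (h y)).trans (hh x y)

theorem injective_of_isOrthogonal (hB : B.Nondegenerate) {g : End K E} (hg : B.IsOrthogonal g) :
    Function.Injective g := by
  refine (injective_iff_map_eq_zero g).2 fun x hx => hB.1 x fun y => ?_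
  rw [← hg, hx, map_zero, LinearMap.zero_apply]

theorem det_mul_self_of_isOrthogonal [FiniteDimensional K E] (hB : B.Nondegenerate)
    {g : End K E} (hg : B.IsOrthogonal g) : LinearMap.det g * LinearMap.det g = 1 := by
  let b := finBasis K E
  have hdet : (LinearMap.BilinForm.toMatrix b B).det ≠ 0 :=
    Matrix.nondegenerate_iff_det_ne_zero.1 ((LinearMap.BilinForm.nondegenerate_toMatrix_iff b).2 hB)
  have hcomp : B.comp g g = B := LinearMap.ext₂ hg
  have h := congrArg (fun C => (LinearMap.BilinForm.toMatrix b C).det) hcomp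
  simp only [LinearMap.BilinForm.toMatrix_comp b b, Matrix.det_mul, Matrix.det_transpose,
    LinearMap.det_toMatrix] at h
  exact mul_right_cancel₀ hdet (by linear_combination h)

theorem isotropicPair_of_isOrthogonal {g : End K E} (hg : B.IsOrthogonal g) {v w : E}
    (h : IsotropicPair B v w) : IsotropicPair B (g v) (g w) := by
  simpa only [IsotropicPair, hg _ _] using h

theorem wedgeEnd_mul_of_isOrthogonal {g : End K E} (hg : B.IsOrthogonal g) (v w : E) :
    wedgeEnd B (g v) (g w) * g = g * wedgeEnd B v w := by
  ext u
  simp only [Module.End.mul_apply, wedgeEnd_apply, hg _ _, map_sub, map_smul]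

theorem exists_isOrthogonal_det_eq_neg_one [FiniteDimensional K E] (hs : B.IsSymm) {u : E}
    (hu : B u u ≠ 0) :
    ∃ g : End K E, B.IsOrthogonal g ∧ LinearMap.det g = -1 ∧
      ∀ x, g x = x - (2 / B u u * B u x) • u := by
  have hg (x : E) : LinearMap.transvection ((2 / B u u) • B u) (-u) x =
      x - (2 / B u u * B u x) • u := by
    simp [LinearMap.transvection.apply, sub_eq_add_neg]
  refine ⟨_, fun x y => ?_, ?_, hg⟩
  · simp only [hg, map_sub, map_smul, LinearMap.sub_apply, LinearMap.smul_apply, smul_eq_mul,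
      hs.eq x u]
    field_simp
    ring
  · rw [LinearMap.transvection.det, LinearMap.smul_apply, map_neg, smul_eq_mul, mul_neg,
      div_mul_cancel₀ _ hu]
    norm_num

theorem exists_mem_orthogonal_apply_ne_zero [FiniteDimensional K E] (hs : B.IsSymm)
    (hB : B.Nondegenerate) {U : Submodule K E} {w : E} (hw : w ∉ U) :
    ∃ x ∈ B.orthogonal U, B w x ≠ 0 := by
  by_contra! h
  refine hw ?_
  rw [← LinearMap.BilinForm.orthogonal_orthogonal hB hs.isRefl U]
  exact fun x hx => (hs.eq _ _).trans (h x hx)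

theorem exists_mem_apply_ne_zero_and_apply_ne_zero {P : Submodule K E} {f f' : Dual K E}
    (hf : ∃ x ∈ P, f x ≠ 0) (hf' : ∃ x ∈ P, f' x ≠ 0) : ∃ x ∈ P, f x ≠ 0 ∧ f' x ≠ 0 := by
  obtain ⟨x, hx, hfx⟩ := hf
  obtain ⟨x', hx', hfx'⟩ := hf'
  by_cases h : f' x = 0
  · by_cases h' : f x' = 0
    · exact ⟨x + x', add_mem hx hx', by simpa [h'] using hfx, by simpa [h] using hfx'⟩
    · exact ⟨x', hx', h', hfx'⟩
  · exact ⟨x, hx, hfx, h⟩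

section Witt

variable [FiniteDimensional K E] [NeZero (2 : K)] {U : Submodule K E}

theorem exists_isOrthogonal_of_apply_ne_zero (hs : B.IsSymm) {w w' : E} (hww : B w w = 0)
    (hww' : B w' w' = 0) (hw : w ∈ B.orthogonal U) (hw' : w' ∈ B.orthogonal U) (h : B w w' ≠ 0) :
    ∃ g : End K E, B.IsOrthogonal g ∧ (∀ x ∈ U, g x = x) ∧ g w = w' := by
  have hself : B (w - w') (w - w') = -2 * B w w' := by
    simp only [map_sub, LinearMap.sub_apply, hww, hww', hs.eq w' w]
    ring
  have hne : B (w - w') (w - w') ≠ 0 := hself ▸ mul_ne_zero (neg_ne_zero.2 two_ne_zero) h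
  obtain ⟨g, hg, -, hgx⟩ := exists_isOrthogonal_det_eq_neg_one hs hne
  refine ⟨g, hg, fun x hx => ?_, ?_⟩
  · have hx0 : B (w - w') x = 0 := (hs.eq _ _).trans (sub_mem hw hw' x hx)
    rw [hgx, hx0, mul_zero, zero_smul, sub_zero]
  · have hw0 : B (w - w') w = -B w w' := by
      simp only [map_sub, LinearMap.sub_apply, hww, hs.eq w' w, zero_sub]
    have hcoeff : 2 / B (w - w') (w - w') * B (w - w') w = 1 := by
      rw [hself] at hne ⊢
      rw [hw0, div_mul_eq_mul_div, div_eq_one_iff_eq hne]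
      ring
    rw [hgx, hcoeff, one_smul, sub_sub_cancel]

/-- If `w` and `w'` are orthogonal, no single reflection exchanges them; one passes through an
isotropic `z` orthogonal to `U` but to neither `w` nor `w'`. -/
theorem exists_isOrthogonal_of_notMem (hs : B.IsSymm) (hB : B.Nondegenerate) {w w' : E}
    (hww : B w w = 0) (hww' : B w' w' = 0) (hw : w ∈ B.orthogonal U) (hw' : w' ∈ B.orthogonal U)
    (hwU : w ∉ U) (hwU' : w' ∉ U) :
    ∃ g : End K E, B.IsOrthogonal g ∧ (∀ x ∈ U, g x = x) ∧ g w = w' := by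
  by_cases h : B w w' = 0
  swap
  · exact exists_isOrthogonal_of_apply_ne_zero hs hww hww' hw hw' h
  obtain ⟨x, hx, hwx, hwx'⟩ := exists_mem_apply_ne_zero_and_apply_ne_zero
    (exists_mem_orthogonal_apply_ne_zero hs hB hwU)
    (exists_mem_orthogonal_apply_ne_zero hs hB hwU')
  obtain ⟨c, hc⟩ : ∃ c, c * (2 * B w x) = B x x :=
    ⟨B x x / (2 * B w x), div_mul_cancel₀ _ (mul_ne_zero two_ne_zero hwx)⟩
  have hz : x - c • w ∈ B.orthogonal U := sub_mem hx (Submodule.smul_mem _ c hw)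
  have hwz : B w (x - c • w) ≠ 0 := by simpa [hww] using hwx
  have hzw' : B (x - c • w) w' ≠ 0 := by simpa [h, hs.eq x w'] using hwx'
  have hzz : B (x - c • w) (x - c • w) = 0 := by
    simp only [map_sub, map_smul, LinearMap.sub_apply, LinearMap.smul_apply, smul_eq_mul, hww,
      hs.eq x w]
    linear_combination -hc
  obtain ⟨g, hg, hgU, hgw⟩ := exists_isOrthogonal_of_apply_ne_zero hs hww hzz hw hz hwz
  obtain ⟨g', hg', hgU', hgw'⟩ := exists_isOrthogonal_of_apply_ne_zero hs hzz hww' hz hw' hzw'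
  exact ⟨g' * g, isOrthogonal_mul hg' hg,
    fun x hx => by rw [End.mul_apply, hgU x hx, hgU' x hx], by rw [End.mul_apply, hgw, hgw']⟩

/-- **Witt's theorem** for totally isotropic frames. -/
theorem exists_isOrthogonal_forall_apply_eq (hs : B.IsSymm) (hB : B.Nondegenerate) {r : ℕ}
    {v v' : Fin r → E} (hv : LinearIndependent K v) (hv' : LinearIndependent K v')
    (h : ∀ i j, B (v i) (v j) = 0) (h' : ∀ i j, B (v' i) (v' j) = 0) :
    ∃ g : End K E, B.IsOrthogonal g ∧ ∀ i, g (v i) = v' i := by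
  induction r with
  | zero => exact ⟨1, fun _ _ => rfl, finZeroElim⟩
  | succ r ih =>
    obtain ⟨hvt', hv0'⟩ := linearIndependent_finSucc.1 hv'
    obtain ⟨g, hg, hgv⟩ := ih (linearIndependent_finSucc.1 hv).1 hvt' (fun _ _ => h _ _)
      fun _ _ => h' _ _
    have htail : Fin.tail (g ∘ v) = Fin.tail v' := funext hgv
    have hgv0 : g (v 0) ∉ Submodule.span K (Set.range (Fin.tail v')) := htail ▸
      (linearIndependent_finSucc.1 (hv.map_injOn g (injective_of_isOrthogonal hB hg).injOn)).2
    have mem_orthogonal {u : Fin (r + 1) → E} (hu : ∀ i j, B (u i) (u j) = 0) :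
        u 0 ∈ B.orthogonal (Submodule.span K (Set.range (Fin.tail u))) := fun x hx => by
      refine (Submodule.span_le (p := LinearMap.ker (B.flip (u 0)))).2 ?_ hx
      rintro _ ⟨i, rfl⟩
      exact hu i.succ 0
    have hgh (i j) : B ((g ∘ v) i) ((g ∘ v) j) = 0 := (hg _ _).trans (h i j)
    obtain ⟨g', hg', hgU', hg0'⟩ := exists_isOrthogonal_of_notMem hs hB (hgh 0 0) (h' 0 0)
      (htail ▸ mem_orthogonal hgh) (mem_orthogonal h') hgv0 hv0'
    refine ⟨g' * g, isOrthogonal_mul hg' hg, Fin.cases hg0' fun i => ?_⟩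
    rw [End.mul_apply, show g (v i.succ) = v' i.succ from hgv i]
    exact hgU' _ (Submodule.subset_span ⟨i, rfl⟩)

theorem exists_mem_orthogonal_apply_self_ne_zero (hs : B.IsSymm) (hB : B.Nondegenerate)
    (hU : 2 * finrank K U < finrank K E) : ∃ u ∈ B.orthogonal U, B u u ≠ 0 := by
  by_contra! h
  have hle : B.orthogonal U ≤ B.orthogonal (B.orthogonal U) := fun x hx y hy => by
    have hxy := h _ (add_mem hx hy)
    simp only [map_add, LinearMap.add_apply, h x hx, h y hy, hs.eq x y] at hxy
    have h2 : (2 : K) * B y x = 0 := by linear_combination hxy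
    exact (mul_eq_zero.1 h2).resolve_left two_ne_zero
  have hfinrank := Submodule.finrank_mono hle
  rw [LinearMap.BilinForm.orthogonal_orthogonal hB hs.isRefl,
    LinearMap.BilinForm.finrank_orthogonal hB] at hfinrank
  omega

theorem exists_isOrthogonal_det_eq_one_forall_apply_eq (hs : B.IsSymm) (hB : B.Nondegenerate)
    {r : ℕ} (hr : 2 * r < finrank K E) {v v' : Fin r → E} (hv : LinearIndependent K v)
    (hv' : LinearIndependent K v') (h : ∀ i j, B (v i) (v j) = 0)
    (h' : ∀ i j, B (v' i) (v' j) = 0) :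
    ∃ g : End K E, B.IsOrthogonal g ∧ LinearMap.det g = 1 ∧ ∀ i, g (v i) = v' i := by
  obtain ⟨g, hg, hgv⟩ := exists_isOrthogonal_forall_apply_eq hs hB hv hv' h h'
  obtain hdet | hdet := mul_self_eq_one_iff.1 (det_mul_self_of_isOrthogonal hB hg)
  · exact ⟨g, hg, hdet, hgv⟩
  obtain ⟨u, hu, huu⟩ := exists_mem_orthogonal_apply_self_ne_zero (U := .span K (Set.range v')) hs
    hB (by rwa [finrank_span_eq_card hv', Fintype.card_fin])
  obtain ⟨ρ, hρ, hρdet, hρx⟩ := exists_isOrthogonal_det_eq_neg_one hs huu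
  refine ⟨ρ * g, isOrthogonal_mul hρ hg, by simp [hρdet, hdet], fun i => ?_⟩
  have hui : B u (v' i) = 0 := (hs.eq _ _).trans (hu _ (Submodule.subset_span ⟨i, rfl⟩))
  rw [End.mul_apply, hgv, hρx, hui, mul_zero, zero_smul, sub_zero]

theorem exists_isOrthogonal_det_eq_one_of_isotropicPair (hs : B.IsSymm) (hB : B.Nondegenerate)
    (hn : 4 < finrank K E) {v w v' w' : E} (h : IsotropicPair B v w) (h' : IsotropicPair B v' w')
    (hi : LinearIndependent K ![v, w]) (hi' : LinearIndependent K ![v', w']) :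
    ∃ g : End K E, B.IsOrthogonal g ∧ LinearMap.det g = 1 ∧ g v = v' ∧ g w = w' := by
  have isotropic {v w : E} (h : IsotropicPair B v w) (i j) :
      B (![v, w] i) (![v, w] j) = 0 := by
    obtain ⟨hvv, hvw, hww⟩ := h
    fin_cases i <;> fin_cases j <;> simp [hvv, hvw, hww, hs.eq w v]
  obtain ⟨g, hg, hdet, hgv⟩ := exists_isOrthogonal_det_eq_one_forall_apply_eq hs hB (r := 2) hn
    hi hi' (isotropic h) (isotropic h')
  exact ⟨g, hg, hdet, hgv 0, hgv 1⟩

theorem mem_isotropicCone_and_ne_zero_iff_exists_isOrthogonal (hs : B.IsSymm)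
    (hB : B.Nondegenerate) (hn : 4 < finrank K E) {X Y : End K E} (hX : X ∈ isotropicCone B)
    (hX0 : X ≠ 0) :
    Y ∈ isotropicCone B ∧ Y ≠ 0 ↔
      ∃ g : End K E, B.IsOrthogonal g ∧ LinearMap.det g = 1 ∧ Y * g = g * X := by
  obtain ⟨v, w, hvw, rfl⟩ := hX
  constructor
  · rintro ⟨⟨v', w', hvw', rfl⟩, hY0⟩
    obtain ⟨g, hg, hdet, rfl, rfl⟩ := exists_isOrthogonal_det_eq_one_of_isotropicPair hs hB hn hvw
      hvw' (linearIndependent_of_wedgeEnd_ne_zero hX0) (linearIndependent_of_wedgeEnd_ne_zero hY0)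
    exact ⟨g, hg, hdet, wedgeEnd_mul_of_isOrthogonal hg v w⟩
  · rintro ⟨g, hg, hdet, hY⟩
    have hunit : IsUnit g := (LinearMap.isUnit_iff_isUnit_det g).2 (hdet ▸ isUnit_one)
    refine ⟨⟨g v, g w, isotropicPair_of_isOrthogonal hg hvw, ?_⟩, ?_⟩
    · rwa [← hunit.mul_left_inj, wedgeEnd_mul_of_isOrthogonal hg]
    · rintro rfl
      rw [zero_mul] at hY
      exact hX0 (hunit.mul_right_eq_zero.1 hY.symm)

end Witt

end Isometries

section Closures

variable {W : Type*} [AddCommGroup W] [Module ℂ W]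

theorem zariskiClosure_mono {S T : Set W} (h : S ⊆ T) : zariskiClosure S ⊆ zariskiClosure T :=
  fun _ hx p hp => hx p fun y hy => hp y (h hy)

theorem zariskiClosure_setOf_forall_eval_eq_zero_subset {ι : Sort*}
    (p : ι → MvPolynomial (Dual ℂ W) ℂ) :
    zariskiClosure {x | ∀ i, MvPolynomial.eval (fun l => l x) (p i) = 0} ⊆
      {x | ∀ i, MvPolynomial.eval (fun l => l x) (p i) = 0} :=
  fun _ hx i => hx (p i) fun _ hy => hy i

theorem exists_eval_eq_bilin_apply_self [FiniteDimensional ℂ W] (β : LinearMap.BilinForm ℂ W) :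
    ∃ p : MvPolynomial (Dual ℂ W) ℂ, ∀ x, MvPolynomial.eval (fun l => l x) p = β x x := by
  let b := finBasis ℂ W
  refine ⟨∑ i, .X (b.coord i) * .X (β (b i)), fun x => ?_⟩
  conv_rhs => enter [1]; rw [← b.sum_repr x]
  simp only [map_sum, map_mul, MvPolynomial.eval_X, Basis.coord_apply, map_smul,
    LinearMap.sum_apply, LinearMap.smul_apply, smul_eq_mul]

theorem zariskiClosure_setOf_forall_apply_self_eq_zero_subset [FiniteDimensional ℂ W] {ι : Sort*}
    {N : Type*} [AddCommGroup N] [Module ℂ N] (β : ι → W →ₗ[ℂ] W →ₗ[ℂ] N) :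
    zariskiClosure {x | ∀ i, β i x x = 0} ⊆ {x | ∀ i, β i x x = 0} := by
  choose p hp using fun (i : ι) (l : Dual ℂ N) => exists_eval_eq_bilin_apply_self ((β i).compr₂ l)
  have h : {x | ∀ i, β i x x = 0} =
      {x | ∀ i : ι ×' Dual ℂ N, MvPolynomial.eval (fun l => l x) (p i.1 i.2) = 0} := by
    ext x
    simp only [hp, LinearMap.compr₂_apply, Set.mem_ofPred_eq, PProd.forall,
      forall_dual_apply_eq_zero_iff]
  rw [h]
  exact zariskiClosure_setOf_forall_eval_eq_zero_subset _

theorem zariskiClosure_preimage_isotropicCone_subset [FiniteDimensional ℂ W] {E : Type*}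
    [AddCommGroup E] [Module ℂ E] {B : LinearMap.BilinForm ℂ E} (hs : B.IsSymm)
    (hB : B.Nondegenerate) (L : W →ₗ[ℂ] End ℂ E) (hL : ∀ x, B.IsSkewAdjoint (L x)) :
    zariskiClosure (L ⁻¹' isotropicCone B) ⊆ L ⁻¹' isotropicCone B := by
  let square : W →ₗ[ℂ] W →ₗ[ℂ] End ℂ E := (LinearMap.mul ℂ (End ℂ E)).compl₁₂ L L
  let plucker (a b : E) : W →ₗ[ℂ] W →ₗ[ℂ] End ℂ E :=
    (LinearMap.lsmul ℂ (End ℂ E) ∘ₗ B.flip b ∘ₗ LinearMap.applyₗ a).compl₁₂ L L -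
      (wedgeEnd B).compl₁₂ (LinearMap.applyₗ a ∘ₗ L) (LinearMap.applyₗ b ∘ₗ L)
  have h : L ⁻¹' isotropicCone B =
      {x | ∀ i : Option (E × E), (i.elim square fun ab => plucker ab.1 ab.2) x x = 0} := by
    ext x
    rw [Set.mem_preimage, mem_isotropicCone_iff hs hB (hL x)]
    simp [square, plucker, Option.forall, sub_eq_zero]
  rw [h]
  exact zariskiClosure_setOf_forall_apply_self_eq_zero_subset _

section Topology

variable [TopologicalSpace W] [ContinuousSMul ℂ W]

theorem closure_subset_zariskiClosure [IsTopologicalAddGroup W] [T2Space W]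
    [FiniteDimensional ℂ W] (S : Set W) : closure S ⊆ zariskiClosure S := by
  intro x hx p hp
  have hcont : Continuous fun y : W => MvPolynomial.eval (fun l : Dual ℂ W => l y) p :=
    (MvPolynomial.continuous_eval p).comp
      (continuous_pi fun l : Dual ℂ W => l.continuous_of_finiteDimensional)
  exact closure_minimal hp (isClosed_singleton.preimage hcont) hx

theorem subset_closure_sdiff_singleton_zero {S : Set W} (hS : ∀ x ∈ S, ∀ c : ℂ, c • x ∈ S)
    (hne : ∃ x ∈ S, x ≠ 0) : S ⊆ closure (S \ {0}) := by
  intro y hy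
  rcases eq_or_ne y 0 with rfl | hy0
  swap
  · exact subset_closure ⟨hy, hy0⟩
  obtain ⟨x, hx, hx0⟩ := hne
  have hlim : Filter.Tendsto (fun c : ℂ => c • x) (nhdsWithin 0 {0}ᶜ) (nhds 0) :=
    ((continuous_id.smul continuous_const).tendsto' 0 0 (zero_smul ℂ x)).mono_left
      nhdsWithin_le_nhds
  refine mem_closure_of_tendsto hlim ?_
  filter_upwards [self_mem_nhdsWithin] with c hc
  exact ⟨hS x hx c, smul_ne_zero hc hx0⟩

end Topology

end Closures

section OrthogonalLieAlgebra

variable {m : ℕ}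

theorem isSymm_form (m : ℕ) : (form m).IsSymm := ⟨form_comm m⟩

theorem form_single_right (v : V m) (i : Fin (2 * m)) :
    form m v (Pi.single i 1) = v (Fin.rev i) := by
  simp [form_apply, Pi.single_apply]

theorem nondegenerate_form (m : ℕ) : (form m).Nondegenerate := by
  refine (isSymm_form m).isRefl.nondegenerate_iff_separatingLeft.2 fun v hv => funext fun i => ?_
  simpa only [form_single_right, Fin.rev_rev, Pi.zero_apply] using hv (Pi.single (Fin.rev i) 1)

theorem isSkewAdjoint_toLin'_iff {A : Matrix (Fin (2 * m)) (Fin (2 * m)) ℂ} :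
    (form m).IsSkewAdjoint (Matrix.toLin' A) ↔ A ∈ so m := by
  simp only [mem_so_iff, LinearMap.IsSkewAdjoint, LinearMap.IsAdjointPair, Matrix.toLin'_apply,
    Pi.neg_apply, map_neg]

variable (m) in
/-- A matrix of `so m`, seen as an endomorphism. -/
def soToEnd : so m →ₗ[ℂ] End ℂ (V m) :=
  Matrix.toLin'.toLinearMap ∘ₗ (so m).toSubmodule.subtype

theorem soToEnd_apply (X : so m) : soToEnd m X = Matrix.toLin' X.1 := rfl

theorem injective_soToEnd (m : ℕ) : Function.Injective (soToEnd m) :=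
  Matrix.toLin'.injective.comp Subtype.val_injective

theorem isSkewAdjoint_soToEnd (X : so m) : (form m).IsSkewAdjoint (soToEnd m X) :=
  isSkewAdjoint_toLin'_iff.2 X.2

theorem range_soToEnd (m : ℕ) : LinearMap.range (soToEnd m) = (form m).skewAdjointSubmodule := by
  ext A
  rw [LinearMap.mem_skewAdjointSubmodule]
  constructor
  · rintro ⟨X, rfl⟩
    exact isSkewAdjoint_soToEnd X
  · intro hA
    refine ⟨⟨LinearMap.toMatrix' A, isSkewAdjoint_toLin'_iff.1 ?_⟩, Matrix.toLin'_toMatrix' A⟩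
    rwa [Matrix.toLin'_toMatrix']

theorem soToEnd_phi_wedge (v w : V m) : soToEnd m (phi m (wedge v w)) = wedgeEnd (form m) v w :=
  LinearMap.ext (phi_wedge_mulVec m v w)

theorem finrank_skewAdjointSubmodule_form (m : ℕ) :
    finrank ℂ (form m).skewAdjointSubmodule = (2 * m).choose 2 := by
  rw [← range_soToEnd, LinearMap.finrank_range_of_inj (injective_soToEnd m),
    ← (bivectorEquivSo m).finrank_eq, exteriorPower.finrank_eq, Module.finrank_fin_fun]

theorem orbitDim_eq_finrank_tangentSpace (X : so m) :
    orbitDim m X = finrank ℂ (tangentSpace (form m) (soToEnd m X)) := by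
  have hcomm : soToEnd m ∘ₗ (LieAlgebra.ad ℂ (so m) X : End ℂ (so m)) =
      (LieAlgebra.ad ℂ (End ℂ (V m)) (soToEnd m X) : End ℂ (End ℂ (V m))) ∘ₗ soToEnd m := by
    ext1 Y
    change Matrix.toLin' (X.1 * Y.1 - Y.1 * X.1) = _
    rw [map_sub, Matrix.toLin'_mul, Matrix.toLin'_mul]
    rfl
  rw [tangentSpace, ← range_soToEnd, ← LinearMap.range_comp, ← hcomm, LinearMap.range_comp]
  exact (Submodule.equivMapOfInjective _ (injective_soToEnd m) _).finrank_eq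

variable (m) in
/-- The elements of `so m` attached to the bivectors of totally isotropic subspaces. -/
def soIsotropicCone : Set (so m) := soToEnd m ⁻¹' isotropicCone (form m)

theorem exists_mem_soIsotropicCone_ne_zero (hm : 2 ≤ m) : ∃ X ∈ soIsotropicCone m, X ≠ 0 := by
  let i : Fin (2 * m) := ⟨0, by omega⟩
  let j : Fin (2 * m) := ⟨1, by omega⟩
  have hform (a b : Fin (2 * m)) (hab : a.1 + b.1 + 1 < 2 * m) :
      form m (Pi.single a 1) (Pi.single b 1) = 0 := by
    rw [form_single_right, Pi.single_eq_of_ne]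
    rw [Ne, Fin.ext_iff, Fin.val_rev]
    omega
  have hij : LinearIndependent ℂ ![(Pi.single i 1 : V m), Pi.single j 1] := by
    have hne : i ≠ j := by simp [i, j]
    refine LinearIndependent.pair_iff.2 fun a b hab => ?_
    have hi := congrFun hab i
    have hj := congrFun hab j
    simp only [Pi.add_apply, Pi.smul_apply, Pi.single_eq_same, Pi.single_eq_of_ne hne,
      Pi.single_eq_of_ne hne.symm, smul_eq_mul, mul_one, mul_zero, add_zero, zero_add,
      Pi.zero_apply] at hi hj
    exact ⟨hi, hj⟩
  have hmap := soToEnd_phi_wedge (Pi.single i 1 : V m) (Pi.single j 1)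
  refine ⟨phi m (wedge (Pi.single i 1) (Pi.single j 1)), ⟨_, _, ⟨?_, ?_, ?_⟩, hmap⟩, fun h => ?_⟩
  · exact hform i i (by change 0 + 0 + 1 < 2 * m; omega)
  · exact hform i j (by change 0 + 1 + 1 < 2 * m; omega)
  · exact hform j j (by change 1 + 1 + 1 < 2 * m; omega)
  · refine wedgeEnd_ne_zero_of_linearIndependent (nondegenerate_form m) hij ?_
    rw [← hmap, h, map_zero]

theorem contract_toDual_wedge (u v w : V m) :
    contract ((form m).toDual (nondegenerate_form m) u) (wedge v w) = wedgeEnd (form m) v w u := by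
  rw [contract, wedgeLift_wedge, wedgeEnd_apply, form_comm m v u, form_comm m w u]
  rfl

theorem isIsotropic_wedge_iff (v w : V m) :
    IsIsotropic (wedge v w) ↔ wedgeEnd (form m) v w * wedgeEnd (form m) v w = 0 := by
  have hA := isSkewAdjoint_wedgeEnd (isSymm_form m) v w
  simp only [IsIsotropic, ((form m).toDual (nondegenerate_form m)).surjective.forall,
    contract_toDual_wedge, bilin_apply_eq_neg_of_isSkewAdjoint hA, neg_eq_zero]
  refine ⟨fun h => LinearMap.ext fun y => ?_, fun h x y => ?_⟩
  · exact (nondegenerate_form m).2 _ fun x => h x y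
  · rw [← Module.End.mul_apply, h, LinearMap.zero_apply, map_zero]

theorem isDecomposable_and_isIsotropic_iff (α : ⋀[ℂ]^2 (V m)) :
    IsDecomposable α ∧ IsIsotropic α ↔ bivectorEquivSo m α ∈ soIsotropicCone m := by
  have hs := isSymm_form m
  constructor
  · rintro ⟨⟨v, w, rfl⟩, hiso⟩
    change soToEnd m (phi m (wedge v w)) ∈ isotropicCone (form m)
    rw [soToEnd_phi_wedge, mem_isotropicCone_iff hs (nondegenerate_form m)
      (isSkewAdjoint_wedgeEnd hs v w)]
    exact ⟨(isIsotropic_wedge_iff v w).1 hiso, bilin_wedgeEnd_smul_wedgeEnd v w⟩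
  · intro hα
    have hsq := mul_self_eq_zero_of_mem_isotropicCone hs hα
    obtain ⟨v, w, -, hvw⟩ := hα
    obtain rfl : α = wedge v w := (bivectorEquivSo m).injective <| injective_soToEnd m <|
      hvw.trans (soToEnd_phi_wedge v w).symm
    exact ⟨⟨v, w, rfl⟩, (isIsotropic_wedge_iff v w).2 (hvw ▸ hsq)⟩

theorem isOrthogonal_toLin'_iff {g : Matrix (Fin (2 * m)) (Fin (2 * m)) ℂ} :
    (form m).IsOrthogonal (Matrix.toLin' g) ↔ g.transpose * J m * g = J m := by
  have h : (form m).comp (Matrix.toLin' g) (Matrix.toLin' g) =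
      Matrix.toBilin' (g.transpose * J m * g) := Matrix.toBilin'_comp _ _ _
  rw [← Matrix.toBilin'.injective.eq_iff, ← h]
  exact ⟨fun hg => LinearMap.ext₂ hg, fun hg x y => LinearMap.congr_fun₂ hg x y⟩

theorem mem_adjointOrbit_iff {X Y : so m} :
    Y ∈ adjointOrbit m X ↔ ∃ g : End ℂ (V m), (form m).IsOrthogonal g ∧ LinearMap.det g = 1 ∧
      soToEnd m Y * g = g * soToEnd m X := by
  have conj_iff (g : Matrix.SpecialLinearGroup (Fin (2 * m)) ℂ) :
      Y.1 = g.1 * X.1 * (g⁻¹).1 ↔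
        soToEnd m Y * Matrix.toLin' g.1 = Matrix.toLin' g.1 * soToEnd m X := by
    have hinv : g.1 * (g⁻¹).1 = 1 := by
      rw [← Matrix.SpecialLinearGroup.coe_mul, mul_inv_cancel, Matrix.SpecialLinearGroup.coe_one]
    have hinv' : (g⁻¹).1 * g.1 = 1 := by
      rw [← Matrix.SpecialLinearGroup.coe_mul, inv_mul_cancel, Matrix.SpecialLinearGroup.coe_one]
    simp only [soToEnd_apply, Module.End.mul_eq_comp, ← Matrix.toLin'_mul,
      Matrix.toLin'.injective.eq_iff]
    constructor <;> intro h
    · rw [h, mul_assoc, hinv', mul_one]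
    · rw [← h, mul_assoc, hinv, mul_one]
  constructor
  · rintro ⟨g, hg, hY⟩
    exact ⟨Matrix.toLin' g.1, isOrthogonal_toLin'_iff.2 hg, by rw [LinearMap.det_toLin', g.2],
      (conj_iff g).1 hY⟩
  · rintro ⟨g, hg, hdet, hY⟩
    obtain ⟨g, rfl⟩ := Matrix.toLin'.surjective g
    rw [LinearMap.det_toLin'] at hdet
    exact ⟨⟨g, hdet⟩, isOrthogonal_toLin'_iff.1 hg, (conj_iff ⟨g, hdet⟩).2 hY⟩

theorem adjointOrbit_eq_soIsotropicCone_sdiff (hm : 3 ≤ m) {X : so m}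
    (hX : X ∈ soIsotropicCone m) (hX0 : X ≠ 0) :
    adjointOrbit m X = soIsotropicCone m \ {0} := by
  ext Y
  have hinj (Z : so m) : soToEnd m Z ≠ 0 ↔ Z ≠ 0 := map_ne_zero_iff _ (injective_soToEnd m)
  rw [mem_adjointOrbit_iff, ← mem_isotropicCone_and_ne_zero_iff_exists_isOrthogonal (isSymm_form m)
    (nondegenerate_form m) (by rw [Module.finrank_fin_fun]; omega) hX ((hinj X).2 hX0), hinj]
  rfl

theorem isNilpotent_soToEnd_iff {X : so m} : IsNilpotent (soToEnd m X) ↔ IsNilpotent X.1 :=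
  IsNilpotent.map_iff (f := Matrix.toLinAlgEquiv' (R := ℂ) (n := Fin (2 * m)))
    Matrix.toLinAlgEquiv'.injective

theorem orbitDim_add_finrank_skewCentralizer (X : so m) :
    orbitDim m X + finrank ℂ (skewCentralizer (form m) (soToEnd m X)) = (2 * m).choose 2 := by
  rw [orbitDim_eq_finrank_tangentSpace, finrank_tangentSpace_add_finrank_skewCentralizer,
    finrank_skewAdjointSubmodule_form]

theorem orbitDim_lt_of_mem_of_notMem {X Y : so m} (hX : X ∈ soIsotropicCone m) (hX0 : X ≠ 0)
    (hY : IsNilpotent Y.1) (hYc : Y ∉ soIsotropicCone m) : orbitDim m X < orbitDim m Y := by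
  have hXdim := finrank_tangentSpace_add_six_le (isSymm_form m) (nondegenerate_form m) hX
    ((map_ne_zero_iff _ (injective_soToEnd m)).2 hX0)
  have hYdim := finrank_skewCentralizer_add_le_of_notMem_isotropicCone (isSymm_form m)
    (nondegenerate_form m) (isSkewAdjoint_soToEnd Y) (isNilpotent_soToEnd_iff.2 hY) hYc
  rw [← orbitDim_eq_finrank_tangentSpace] at hXdim
  rw [Module.finrank_fin_fun] at hXdim hYdim
  have := orbitDim_add_finrank_skewCentralizer Y
  omega

theorem orbitDim_zero (m : ℕ) : orbitDim m 0 = 0 := by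
  have had : LieAlgebra.ad ℂ (so m) 0 = 0 := map_zero _
  rw [orbitDim, had, LinearMap.range_zero, finrank_bot]

theorem orbitDim_pos {X : so m} (hX : X ∈ soIsotropicCone m) (hX0 : X ≠ 0) : 0 < orbitDim m X := by
  have hlt := finrank_skewCentralizer_lt_of_mem_isotropicCone (isSymm_form m)
    (nondegenerate_form m) hX ((map_ne_zero_iff _ (injective_soToEnd m)).2 hX0)
  rw [Module.finrank_fin_fun] at hlt
  have := orbitDim_add_finrank_skewCentralizer X
  omega

theorem exists_isMinimalNilpotentOrbit {X : so m} (hX : IsNilpotent X.1) (hpos : 0 < orbitDim m X) :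
    ∃ O, IsMinimalNilpotentOrbit m O := by
  obtain ⟨Y, ⟨hY, hYpos⟩, hmin⟩ := (measure (orbitDim m)).wf.has_min
    {Y | IsNilpotent Y.1 ∧ 0 < orbitDim m Y} ⟨X, hX, hpos⟩
  exact ⟨_, Y, rfl, hY, hYpos, fun Z hZ hZpos => not_lt.1 (hmin Z ⟨hZ, hZpos⟩)⟩

theorem isMinimalNilpotentOrbit_iff (hm : 3 ≤ m) (O : Set (so m)) :
    IsMinimalNilpotentOrbit m O ↔ O = soIsotropicCone m \ {0} := by
  obtain ⟨X, hX, hX0⟩ := exists_mem_soIsotropicCone_ne_zero (m := m) (by omega)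
  have hpos := orbitDim_pos hX hX0
  have hnil : IsNilpotent X.1 := isNilpotent_soToEnd_iff.1
    ⟨2, by rw [pow_two, mul_self_eq_zero_of_mem_isotropicCone (isSymm_form m) hX]⟩
  have eq_of_isMinimal {O : Set (so m)} (hO : IsMinimalNilpotentOrbit m O) :
      O = soIsotropicCone m \ {0} := by
    obtain ⟨Y, rfl, hY, hYpos, hmin⟩ := hO
    refine adjointOrbit_eq_soIsotropicCone_sdiff hm ?_ ?_
    · by_contra hYc
      exact (hmin X hnil hpos).not_gt (orbitDim_lt_of_mem_of_notMem hX hX0 hY hYc)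
    · rintro rfl
      exact hYpos.ne' (orbitDim_zero m)
  refine ⟨eq_of_isMinimal, fun hO => ?_⟩
  obtain ⟨O', hO'⟩ := exists_isMinimalNilpotentOrbit hnil hpos
  rwa [hO, ← eq_of_isMinimal hO']

theorem zariskiClosure_soIsotropicCone_subset (m : ℕ) :
    zariskiClosure (soIsotropicCone m) ⊆ soIsotropicCone m :=
  zariskiClosure_preimage_isotropicCone_subset (isSymm_form m) (nondegenerate_form m) (soToEnd m)
    isSkewAdjoint_soToEnd

theorem soIsotropicCone_subset_closure_sdiff (hm : 2 ≤ m) :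
    soIsotropicCone m ⊆ closure (soIsotropicCone m \ {0}) :=
  subset_closure_sdiff_singleton_zero
    (fun X hX c => by
      rw [soIsotropicCone, Set.mem_preimage, map_smul]
      exact smul_mem_isotropicCone hX c)
    (exists_mem_soIsotropicCone_ne_zero hm)

theorem closure_subset_zariskiClosure_so (S : Set (so m)) : closure S ⊆ zariskiClosure S :=
  haveI : IsTopologicalAddGroup (so m) :=
    inferInstanceAs (IsTopologicalAddGroup (so m).toSubmodule)
  closure_subset_zariskiClosure S

theorem zariskiClosure_soIsotropicCone_sdiff (hm : 2 ≤ m) :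
    zariskiClosure (soIsotropicCone m \ {0}) = soIsotropicCone m :=
  ((zariskiClosure_mono Set.sdiff_subset).trans
    (zariskiClosure_soIsotropicCone_subset m)).antisymm
    ((soIsotropicCone_subset_closure_sdiff hm).trans (closure_subset_zariskiClosure_so _))

theorem closure_soIsotropicCone_sdiff (hm : 2 ≤ m) :
    closure (soIsotropicCone m \ {0}) = soIsotropicCone m :=
  ((closure_subset_zariskiClosure_so _).trans
    (zariskiClosure_soIsotropicCone_sdiff hm).subset).antisymm
    (soIsotropicCone_subset_closure_sdiff hm)

end OrthogonalLieAlgebra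

end MinOrbit

end

theorem mainTheorem10_general (m : ℕ) (hm : 3 ≤ m) :
    (∃! O : Set (MinOrbit.so m), MinOrbit.IsMinimalNilpotentOrbit m O) ∧
    ∀ O : Set (MinOrbit.so m), MinOrbit.IsMinimalNilpotentOrbit m O →
      MinOrbit.bivectorEquivSo m ⁻¹' MinOrbit.zariskiClosure O =
        {α | MinOrbit.IsDecomposable α ∧ MinOrbit.IsIsotropic α} ∧
      MinOrbit.bivectorEquivSo m ⁻¹' closure O =
        {α | MinOrbit.IsDecomposable α ∧ MinOrbit.IsIsotropic α} := by
  have hcone : MinOrbit.bivectorEquivSo m ⁻¹' MinOrbit.soIsotropicCone m =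
      {α | MinOrbit.IsDecomposable α ∧ MinOrbit.IsIsotropic α} :=
    Set.ext fun α => (MinOrbit.isDecomposable_and_isIsotropic_iff α).symm
  simp only [MinOrbit.isMinimalNilpotentOrbit_iff hm, existsUnique_eq, forall_eq,
    MinOrbit.zariskiClosure_soIsotropicCone_sdiff (by omega : 2 ≤ m),
    MinOrbit.closure_soIsotropicCone_sdiff (by omega : 2 ≤ m), hcone, and_self]

theorem mainTheorem10 (m : ℕ) (hm : 4 ≤ m) :
    (∃! O : Set (MinOrbit.so m), MinOrbit.IsMinimalNilpotentOrbit m O) ∧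
    ∀ O : Set (MinOrbit.so m), MinOrbit.IsMinimalNilpotentOrbit m O →
      MinOrbit.bivectorEquivSo m ⁻¹' MinOrbit.zariskiClosure O =
        {α | MinOrbit.IsDecomposable α ∧ MinOrbit.IsIsotropic α} ∧
      MinOrbit.bivectorEquivSo m ⁻¹' closure O =
        {α | MinOrbit.IsDecomposable α ∧ MinOrbit.IsIsotropic α} :=
  mainTheorem10_general m (by omega)
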